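/- Let $V$ be a finite set and let $\Delta$ be a simplicial complex on the vertex set $V$: a collection of subsets of $V$ (faces), closed under taking subsets, containing $\emptyset$ and all $\{v\}$, $v\in V$. Put $\dim F=|F|-1$ for a face $F$, let $\dim\Delta$ be the maximal dimension of a face, and call the inclusion-maximal faces facets. $\Delta$ is pure if all its facets have the same dimension. A chain between facets $F,G$ is a sequence of facets $F=F_0,\dots,F_n=G$ ($n\ge 0$) with $F_i\cap F_{i+1}\ne\emptyset$ for $0\le i<n$. $\Delta$ is connected if any two facets are joined by a chain, and connected in codimension $1$ if any two facets $F,G$ with $\dim F\ge\dim G$ are joined by a chain with $\dim(F_i\cap F_{i+1})=\dim F_{i+1}-1$ for $0\le i<n$. A facet $F$ is a leaf of a complex if it is its only facet, or if there is a facet $G\ne F$ such that $F\cap H\subseteq F\cap G$ for all facets $H\neq F$. $\Delta$ is a tree if it is connected and every nonempty subcomplex (a complex whose facets are all facets of $\Delta$) has a leaf. Let $K$ be a field and $R=K[x_v : v\in V]$, with its standard grading. The facet ideal of $\Delta$ is the ideal $I\subset R$ generated by the monomials $\prod_{v\in F}x_v$, where $F$ runs over the facets of $\Delta$. For a finitely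 generated graded $R$-module $M$, let $b_{i,j}(M)$ denote the graded Betti numbers: the $i$-th module in the minimal graded free resolution of $M$ is $\bigoplus_j R(-j)^{b_{i,j}(M)}$. **Proposition.** Let $\Delta$ be a pure tree of dimension $d\ge 0$ with $m$ facets which is connected in codimension $1$, and let $I$ be its facet ideal. For each face $G$ let $m(G)$ be the number of facets of $\Delta$ containing $G$, and call a face $G$ adjacent if $\dim G=d-1$ and $m(G)\ge 2$. Then $$b_{1,1+d}(R/I)=m,\qquad b_{i,i+d}(R/I)=\sum_{G\text{ adjacent}}\binom{m(G)}{i}\quad\text{for all } i\ge 2 .$$ -/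

import Mathlib

/-! ### Simplicial complexes, facets, trees

Mathlib's simplicial complexes do not list the empty set among the faces; `IsFace` adds it.
A complex over `V` all of whose one-point sets are faces is an `AbstractSimplicialComplex V`;
subcomplexes of it need not contain all vertices and are `PreAbstractSimplicialComplex V`. -/

/-- The dimension `|F| - 1` of a face; in particular `dim ∅ = -1`. -/
def faceDim {V : Type*} (F : Finset V) : ℤ := (F.card : ℤ) - 1

namespace PreAbstractSimplicialComplex

variable {V : Type*}

/-- Faces, including the empty face. -/
def IsFace (Δ : PreAbstractSimplicialComplex V) (G : Finset V) : Prop := G = ∅ ∨ G ∈ Δ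

open Classical in
/-- The facets: the faces that are maximal under inclusion. -/
noncomputable def facets [Fintype V] (Δ : PreAbstractSimplicialComplex V) : Finset (Finset V) :=
  {F : Finset V | Maximal (fun s => s ∈ Δ) F}

/-- `d` is the maximal dimension of a face of `Δ`. -/
def HasDim (Δ : PreAbstractSimplicialComplex V) (d : ℕ) : Prop :=
  IsGreatest {e : ℤ | ∃ F : Finset V, F ∈ Δ ∧ faceDim F = e} (d : ℤ)

/-- All facets have the same dimension. -/
def IsPure [Fintype V] (Δ : PreAbstractSimplicialComplex V) : Prop :=
  ∀ F ∈ Δ.facets, ∀ G ∈ Δ.facets, faceDim F = faceDim G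

/-- `C 0, …, C n` is a chain between the facets `F` and `G`. -/
def IsChainBetween [Fintype V] [DecidableEq V] (Δ : PreAbstractSimplicialComplex V)
    (F G : Finset V) (n : ℕ) (C : ℕ → Finset V) : Prop :=
  C 0 = F ∧ C n = G ∧ (∀ i ≤ n, C i ∈ Δ.facets) ∧ ∀ i < n, C i ∩ C (i + 1) ≠ ∅

/-- Any two facets are joined by a chain. -/
def IsConnected [Fintype V] [DecidableEq V] (Δ : PreAbstractSimplicialComplex V) : Prop :=
  ∀ F ∈ Δ.facets, ∀ G ∈ Δ.facets, ∃ (n : ℕ) (C : ℕ → Finset V), Δ.IsChainBetween F G n C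

/-- Any two facets `F`, `G` with `dim F ≥ dim G` are joined by a proper chain. -/
def IsConnectedInCodimOne [Fintype V] [DecidableEq V] (Δ : PreAbstractSimplicialComplex V) :
    Prop :=
  ∀ F ∈ Δ.facets, ∀ G ∈ Δ.facets, faceDim G ≤ faceDim F →
    ∃ (n : ℕ) (C : ℕ → Finset V), Δ.IsChainBetween F G n C ∧
      ∀ i < n, faceDim (C i ∩ C (i + 1)) = faceDim (C (i + 1)) - 1

/-- A facet `F` is a leaf if it is the only facet, or if there is a facet `G ≠ F` such that
`F ∩ H ⊆ F ∩ G` for every facet `H ≠ F`. -/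
def IsLeaf [Fintype V] [DecidableEq V] (Δ : PreAbstractSimplicialComplex V) (F : Finset V) :
    Prop :=
  F ∈ Δ.facets ∧
    (Δ.facets = {F} ∨
      ∃ G ∈ Δ.facets, G ≠ F ∧ ∀ H ∈ Δ.facets, H ≠ F → F ∩ H ⊆ F ∩ G)

/-- A tree in the sense of Faridi: a connected complex each of whose nonempty subcomplexes has a
leaf, a subcomplex being a complex all of whose facets are facets of `Δ`. -/
def IsTree [Fintype V] [DecidableEq V] (Δ : PreAbstractSimplicialComplex V) : Prop :=
  Δ.IsConnected ∧
    ∀ Γ : PreAbstractSimplicialComplex V,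
      Γ.facets ⊆ Δ.facets → Γ.facets.Nonempty → ∃ F : Finset V, Γ.IsLeaf F

/-- The number `m(G)` of facets that contain `G`. -/
noncomputable def facetCount [Fintype V] [DecidableEq V] (Δ : PreAbstractSimplicialComplex V)
    (G : Finset V) : ℕ :=
  (Δ.facets.filter (fun F => G ⊆ F)).card

open Classical in
/-- The adjacent faces of a `d`-dimensional complex: the faces of dimension `d - 1` that are
contained in at least two facets. -/
noncomputable def adjacentFaces [Fintype V] (Δ : PreAbstractSimplicialComplex V)
    (d : ℕ) : Finset (Finset V) :=
  {G : Finset V | Δ.IsFace G ∧ faceDim G = (d : ℤ) - 1 ∧ 2 ≤ Δ.facetCount G}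

/-- The facet ideal: generated by the squarefree monomials `∏ v ∈ F, X v`, `F` a facet. -/
noncomputable def facetIdeal [Fintype V] (K : Type*) [Field K]
    (Δ : PreAbstractSimplicialComplex V) : Ideal (MvPolynomial V K) :=
  Ideal.span {f | ∃ F ∈ Δ.facets, f = ∏ v ∈ F, MvPolynomial.X v}

end PreAbstractSimplicialComplex

/-! ### Graded Betti numbers -/

namespace MvPolynomial

/-- The homogeneous component `R_j`, `j ∈ ℤ`, of the standard graded polynomial ring
(zero for `j < 0`). -/
def gradedPart (K σ : Type*) [Field K] (j : ℤ) : Submodule K (MvPolynomial σ K) where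
  carrier := {p | ∀ m : σ →₀ ℕ, coeff m p ≠ 0 → (m.degree : ℤ) = j}
  zero_mem' := by
    intro m hm
    simp at hm
  add_mem' := by
    intro p q hp hq m hm
    by_cases h : coeff m p = 0
    · exact hq m (by simpa [h] using hm)
    · exact hp m h
  smul_mem' := by
    intro c p hp m hm
    refine hp m fun h => hm ?_
    simp [h]

/-- The grading of `R/I` by the images of the components `R_j` (for a homogeneous ideal `I`). -/
noncomputable def quotientGradedPart {K σ : Type*} [Field K] (I : Ideal (MvPolynomial σ K))
    (j : ℤ) : Submodule K (MvPolynomial σ K ⧸ I) :=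
  (gradedPart K σ j).map (Ideal.Quotient.mkₐ K I).toLinearMap

end MvPolynomial

/-- A minimal graded free resolution `⋯ → F₂ → F₁ → F₀ → M → 0` of a graded module `M` with
homogeneous components `𝓜 j` over `R = K[x_v : v ∈ σ]`. Here `Fᵢ` is the free module with a basis
`e_k`, `k < rank i`, in which `e_k` has degree `deg i k`; that is,
`Fᵢ = ⨁ₖ R(-deg i k)`. -/
structure MinimalGradedFreeResolution {K σ M : Type*} [Field K] [AddCommGroup M]
    [Module K M] [Module (MvPolynomial σ K) M] (𝓜 : ℤ → Submodule K M) where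
  /-- the rank of `Fᵢ` -/
  rank : ℕ → ℕ
  /-- the degrees of the basis elements of `Fᵢ` -/
  deg : ∀ i, Fin (rank i) → ℤ
  /-- the differential `Fᵢ₊₁ → Fᵢ` -/
  d : ∀ i, (Fin (rank (i + 1)) → MvPolynomial σ K) →ₗ[MvPolynomial σ K]
    (Fin (rank i) → MvPolynomial σ K)
  /-- the augmentation `F₀ → M` -/
  ε : (Fin (rank 0) → MvPolynomial σ K) →ₗ[MvPolynomial σ K] M
  /-- the differentials are homogeneous of degree `0` -/
  d_homogeneous : ∀ i k l,
    d i (Pi.single k 1) l ∈ MvPolynomial.gradedPart K σ (deg (i + 1) k - deg i l)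
  /-- the augmentation is homogeneous of degree `0` -/
  ε_homogeneous : ∀ k, ε (Pi.single k 1) ∈ 𝓜 (deg 0 k)
  ε_surjective : Function.Surjective ε
  exact_zero : Function.Exact (d 0) ε
  exact_succ : ∀ i, Function.Exact (d (i + 1)) (d i)
  /-- minimality: the image of `Fᵢ₊₁` lies in `𝔪 Fᵢ`, where `𝔪 = (x_v : v ∈ σ)` -/
  minimal : ∀ i k l,
    d i (Pi.single k 1) l ∈ Ideal.span (Set.range (MvPolynomial.X : σ → MvPolynomial σ K))

/-- The number of summands `R(-j)` in the `i`-th module of the resolution. -/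
def MinimalGradedFreeResolution.betti {K σ M : Type*} [Field K] [AddCommGroup M]
    [Module K M] [Module (MvPolynomial σ K) M] {𝓜 : ℤ → Submodule K M}
    (F : MinimalGradedFreeResolution (σ := σ) 𝓜) (i : ℕ) (j : ℤ) : ℕ :=
  (Finset.univ.filter (fun k => F.deg i k = j)).card

/-- The graded Betti number `b_{i,j}` of the graded module with components `𝓜` is well defined
and equal to `b`: a minimal graded free resolution exists, and in every such resolution
the summand `R(-j)` occurs exactly `b` times in homological degree `i`. -/
def HasGradedBetti {K M : Type*} (σ : Type*) [Field K] [AddCommGroup M]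
    [Module K M] [Module (MvPolynomial σ K) M] (𝓜 : ℤ → Submodule K M)
    (i : ℕ) (j : ℤ) (b : ℕ) : Prop :=
  Nonempty (MinimalGradedFreeResolution (σ := σ) 𝓜) ∧
    ∀ F : MinimalGradedFreeResolution (σ := σ) 𝓜, F.betti i j = b

/-! ### Graded pieces of free modules -/

namespace MvPolynomial

variable {K σ : Type*} [Field K]

/-! All facets have `d + 1` vertices, so `I` starts in degree `d + 1` and `b_{i,i+d}(R/I)` lies on
its linear strand. In terms of `Tor`, this number is the dimension of the Koszul homology of `I` in
exterior degree `i - 1` and internal degree `i + d`. Since `I` vanishes in degree `d`, there are no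
boundaries there: the Betti number is the dimension of the space of Koszul cycles in exterior degree
`i - 1` with coefficients in `I_{d+1}`, the span of the facet monomials.

No theory of `Tor` enters. A minimal cover `φ` whose generators have degree at least `e` identifies
Koszul cycles over `(im φ)_e` in exterior degree `p + 1` with those over `(ker φ)_{e+1}` in exterior
degree `p` (`finrank_koszulCycles_range_succ`). This rests on exactness of the Koszul complex at
linear coefficients (`exists_koszulBoundary_eq`). Walking along the resolution until the exterior
degree is `0` leaves a graded piece of a syzygy module, whose dimension counts generators
(`betti_eq_finrank_koszulCycles`).

The cycles are counted by removing leaves. Let `F` be a leaf, `B ⊂ F` a proper subset containing all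
`F ∩ H`, and `W` the set of `w` with `B ∪ {w}` among the other facets. Reading off the coefficient
of the monomial of `F` maps the cycles in exterior degree `n > 0` onto the functions on `n`-subsets
of `W`, and the kernel consists of the cycles of the smaller family (`finrank_koszulCycles_insert`).
So `F` contributes `|W|.choose n`. By Pascal's rule this is also the growth of the sum of
`m(G).choose (n + 1)` over the `d`-subsets `G` (`sum_choose_insert`), and induction concludes. -/

lemma mul_mem_gradedPart {a b : ℤ} {p q : MvPolynomial σ K} (hp : p ∈ gradedPart K σ a)
    (hq : q ∈ gradedPart K σ b) : p * q ∈ gradedPart K σ (a + b) := by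
  classical
  intro m hm
  rw [coeff_mul] at hm
  obtain ⟨x, hx, hne⟩ := Finset.exists_ne_zero_of_sum_ne_zero hm
  rw [← Finset.HasAntidiagonal.mem_antidiagonal.1 hx, ← hp _ (left_ne_zero_of_mul hne),
    ← hq _ (right_ne_zero_of_mul hne)]
  simp

lemma X_mem_gradedPart (v : σ) : (X v : MvPolynomial σ K) ∈ gradedPart K σ 1 := by
  classical
  intro m hm
  rw [coeff_X] at hm
  rw [← (ite_ne_right_iff.1 hm).1]
  simp

lemma C_mem_gradedPart (c : K) : (C c : MvPolynomial σ K) ∈ gradedPart K σ 0 := by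
  classical
  intro m hm
  rw [coeff_C] at hm
  rw [← (ite_ne_right_iff.1 hm).1]
  simp

lemma eq_C_of_mem_gradedPart {j : ℤ} (hj : j ≤ 0) {p : MvPolynomial σ K}
    (hp : p ∈ gradedPart K σ j) : p = C (coeff 0 p) := by
  classical
  ext m
  rw [coeff_C]
  split_ifs with h
  · rw [h]
  · by_contra hne
    have := hp m hne
    have h0 : m.degree = 0 := by lia
    exact h ((Finsupp.degree_eq_zero_iff m).1 h0).symm

lemma eq_zero_of_mem_gradedPart {j : ℤ} (hj : j ≤ 0) {p : MvPolynomial σ K}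
    (hp : p ∈ gradedPart K σ j) (h0 : coeff 0 p = 0) : p = 0 := by
  rw [eq_C_of_mem_gradedPart hj hp, h0, C_0]

lemma coeff_zero_of_mem_gradedPart {j : ℤ} (hj : j ≠ 0) {p : MvPolynomial σ K}
    (hp : p ∈ gradedPart K σ j) : coeff 0 p = 0 := by
  by_contra h
  exact hj (by simpa using (hp 0 h).symm)

lemma mem_span_range_X {p : MvPolynomial σ K} :
    p ∈ Ideal.span (Set.range (X : σ → MvPolynomial σ K)) ↔ coeff 0 p = 0 := by
  rw [← Set.image_univ, mem_ideal_span_X_image]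
  constructor
  · intro h
    by_contra hne
    simpa using h 0 (mem_support_iff.2 hne)
  · intro h m hm
    by_contra! hcon
    have : m = 0 := by ext v; simpa using hcon v
    exact mem_support_iff.1 hm (this ▸ h)

/-- The projection of the polynomial ring onto its component of degree `j`. -/
noncomputable def gradedProj (j : ℤ) : MvPolynomial σ K →ₗ[K] MvPolynomial σ K :=
  if 0 ≤ j then homogeneousComponent j.toNat else 0

lemma coeff_gradedProj (j : ℤ) (m : σ →₀ ℕ) (p : MvPolynomial σ K) :
    coeff m (gradedProj j p) = if (m.degree : ℤ) = j then coeff m p else 0 := by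
  unfold gradedProj
  split_ifs with h h' h'
  · rw [coeff_homogeneousComponent, if_pos (by lia)]
  · rw [coeff_homogeneousComponent, if_neg (by lia)]
  · lia
  · simp

lemma gradedProj_mem (j : ℤ) (p : MvPolynomial σ K) : gradedProj j p ∈ gradedPart K σ j := by
  intro m hm
  rw [coeff_gradedProj] at hm
  exact (ite_ne_right_iff.1 hm).1

lemma gradedProj_of_mem {j : ℤ} {p : MvPolynomial σ K} (hp : p ∈ gradedPart K σ j) :
    gradedProj j p = p := by
  ext m
  rw [coeff_gradedProj]
  split_ifs with h
  · rfl
  · by_contra hne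
    exact h (hp m (Ne.symm hne))

lemma gradedProj_mul {a : ℤ} (j : ℤ) (f : MvPolynomial σ K) {g : MvPolynomial σ K}
    (hg : g ∈ gradedPart K σ a) : gradedProj j (f * g) = gradedProj (j - a) f * g := by
  classical
  ext n
  have key : ∀ x ∈ Finset.HasAntidiagonal.antidiagonal n,
      coeff x.1 (gradedProj (j - a) f) * coeff x.2 g =
        if (n.degree : ℤ) = j then coeff x.1 f * coeff x.2 g else 0 := fun x hx => by
    by_cases hne : coeff x.2 g = 0
    · simp [hne]
    have h3 := hg _ hne
    have h4 : n.degree = x.1.degree + x.2.degree := by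
      rw [← Finset.HasAntidiagonal.mem_antidiagonal.1 hx]; simp
    rw [coeff_gradedProj]
    split_ifs <;> first | rfl | (exfalso; lia) | simp
  rw [coeff_gradedProj, coeff_mul, coeff_mul, Finset.sum_congr rfl key]
  split_ifs <;> simp

variable {ι κ : Type*}

/-- The component of degree `j` of the free module with a basis of degrees `b`. -/
def gradedVec (b : ι → ℤ) (j : ℤ) : Submodule K (ι → MvPolynomial σ K) where
  carrier := {f | ∀ l, f l ∈ gradedPart K σ (j - b l)}
  zero_mem' := fun _ => Submodule.zero_mem _
  add_mem' := fun hf hg l => Submodule.add_mem _ (hf l) (hg l)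
  smul_mem' := fun c _ hf l => Submodule.smul_mem _ c (hf l)

/-- The projection of a graded free module onto its component of degree `j`. -/
noncomputable def vecProj (b : ι → ℤ) (j : ℤ) :
    (ι → MvPolynomial σ K) →ₗ[K] (ι → MvPolynomial σ K) :=
  LinearMap.pi fun l => gradedProj (j - b l) ∘ₗ LinearMap.proj l

@[simp] lemma vecProj_apply (b : ι → ℤ) (j : ℤ) (f : ι → MvPolynomial σ K) (l : ι) :
    vecProj b j f l = gradedProj (j - b l) (f l) :=
  rfl

lemma vecProj_mem (b : ι → ℤ) (j : ℤ) (f : ι → MvPolynomial σ K) :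
    vecProj b j f ∈ gradedVec b j :=
  fun _ => gradedProj_mem _ _

lemma vecProj_of_mem {b : ι → ℤ} {j : ℤ} {f : ι → MvPolynomial σ K} (hf : f ∈ gradedVec b j) :
    vecProj b j f = f := by
  ext1 l
  exact gradedProj_of_mem (hf l)

lemma exists_sum_vecProj [Fintype ι] (b : ι → ℤ) (f : ι → MvPolynomial σ K) :
    ∃ J : Finset ℤ, ∑ j ∈ J, vecProj b j f = f := by
  classical
  refine ⟨Finset.univ.biUnion fun l => (f l).support.image fun m => (m.degree : ℤ) + b l, ?_⟩
  ext l m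
  rw [Finset.sum_apply, coeff_sum]
  simp only [vecProj_apply, coeff_gradedProj]
  by_cases h : coeff m (f l) = 0
  · simp [h]
  · rw [Finset.sum_eq_single ((m.degree : ℤ) + b l)]
    · simp
    · intro j _ hj
      exact if_neg (by lia)
    · intro hn
      refine absurd ?_ hn
      exact Finset.mem_biUnion.2 ⟨l, Finset.mem_univ l,
        Finset.mem_image.2 ⟨m, mem_support_iff.2 h, rfl⟩⟩

lemma smul_mem_gradedVec {b : ι → ℤ} {i j : ℤ} {p : MvPolynomial σ K}
    (hp : p ∈ gradedPart K σ i) {f : ι → MvPolynomial σ K} (hf : f ∈ gradedVec b j) :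
    p • f ∈ gradedVec b (i + j) := by
  intro l
  have := mul_mem_gradedPart hp (hf l)
  rwa [← add_sub_assoc] at this

section GradedMap

variable [Fintype ι] [DecidableEq ι]
  {a : ι → ℤ} {b : κ → ℤ} {φ : (ι → MvPolynomial σ K) →ₗ[MvPolynomial σ K] (κ → MvPolynomial σ K)}

/-- Compatibility with the projections makes kernels of homogeneous maps graded and lets homogeneous
elements of the image be lifted to homogeneous elements. -/
lemma map_vecProj (hφ : ∀ k l, φ (Pi.single k 1) l ∈ gradedPart K σ (a k - b l)) (j : ℤ)
    (f : ι → MvPolynomial σ K) : φ (vecProj a j f) = vecProj b j (φ f) := by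
  ext1 l
  rw [LinearMap.pi_apply_eq_sum_univ φ, vecProj_apply, LinearMap.pi_apply_eq_sum_univ φ,
    Finset.sum_apply, Finset.sum_apply, map_sum]
  refine Finset.sum_congr rfl fun k _ => ?_
  simp only [Pi.smul_apply, smul_eq_mul, vecProj_apply]
  have h : (fun i => if k = i then (1 : MvPolynomial σ K) else 0) = Pi.single k 1 := by
    ext1 i; simp [Pi.single_apply, eq_comm]
  rw [h, gradedProj_mul _ _ (hφ k l)]
  rw [show j - b l - (a k - b l) = j - a k by ring]

lemma map_mem_gradedVec (hφ : ∀ k l, φ (Pi.single k 1) l ∈ gradedPart K σ (a k - b l)) {j : ℤ}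
    {f : ι → MvPolynomial σ K} (hf : f ∈ gradedVec a j) : φ f ∈ gradedVec b j := by
  rw [← vecProj_of_mem hf, map_vecProj hφ]
  exact vecProj_mem _ _ _

lemma exists_mem_gradedVec_of_mem_range
    (hφ : ∀ k l, φ (Pi.single k 1) l ∈ gradedPart K σ (a k - b l)) {j : ℤ}
    {g : κ → MvPolynomial σ K} (hg : g ∈ gradedVec b j) (hr : g ∈ LinearMap.range φ) :
    ∃ f ∈ gradedVec a j, φ f = g := by
  obtain ⟨f, rfl⟩ := hr
  exact ⟨vecProj a j f, vecProj_mem _ _ _, by rw [map_vecProj hφ, vecProj_of_mem hg]⟩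

end GradedMap

/-- When no generator has degree below `e`, the component of degree `e` consists of constant
vectors, and a minimal cover kills no nonzero constant vector. This gives injectivity in lowest
degree. -/
lemma eq_zero_of_mem_gradedVec {a : ι → ℤ}
    {φ : (ι → MvPolynomial σ K) →ₗ[MvPolynomial σ K] (κ → MvPolynomial σ K)}
    (hker : ∀ f ∈ LinearMap.ker φ, ∀ k, coeff 0 (f k) = 0) {e : ℤ}
    (ha : ∀ k, e ≤ a k) {f : ι → MvPolynomial σ K} (hf : f ∈ gradedVec a e) (h0 : φ f = 0) :
    f = 0 := by
  ext1 k
  exact eq_zero_of_mem_gradedPart (sub_nonpos.2 (ha k)) (hf k) (hker f h0 k)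

end MvPolynomial

/-! ### Koszul cycles -/

namespace MvPolynomial

section Sign

variable {V : Type*} [Fintype V] [DecidableEq V]

/-- The sign of `v` in the Koszul complex on `T ∪ {v}`, for an arbitrary fixed order of `V`. -/
noncomputable def koszulSign (v : V) (T : Finset V) : ℤ :=
  (-1) ^ (T.filter fun w => Fintype.equivFin V w < Fintype.equivFin V v).card

omit [DecidableEq V] in
lemma koszulSign_mul_self (v : V) (T : Finset V) : koszulSign v T * koszulSign v T = 1 := by
  rw [koszulSign, ← mul_pow]
  simp

lemma koszulSign_insert_of_lt {u v : V} {T : Finset V} (hu : u ∉ T)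
    (h : Fintype.equivFin V u < Fintype.equivFin V v) :
    koszulSign v (insert u T) = -koszulSign v T := by
  rw [koszulSign, koszulSign, Finset.filter_insert, if_pos h, Finset.card_insert_of_notMem,
    pow_succ]
  · ring
  · exact fun h => hu (Finset.mem_filter.1 h).1

lemma koszulSign_insert_of_gt {u v : V} {T : Finset V}
    (h : Fintype.equivFin V v < Fintype.equivFin V u) :
    koszulSign v (insert u T) = koszulSign v T := by
  rw [koszulSign, koszulSign, Finset.filter_insert, if_neg h.not_gt]

/-- Adjoining `u` and `v` in the two possible orders gives opposite signs, because exactly one of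
the two precedes the other. The square of the Koszul differential cancels in such pairs. -/
lemma koszulSign_mul_insert {u v : V} {T : Finset V} (hu : u ∉ T) (hv : v ∉ T) (huv : u ≠ v) :
    koszulSign v T * koszulSign u (insert v T) = -(koszulSign u T * koszulSign v (insert u T)) := by
  have hne : Fintype.equivFin V u ≠ Fintype.equivFin V v := fun h =>
    huv ((Fintype.equivFin V).injective h)
  rcases hne.lt_or_gt with h | h
  · rw [koszulSign_insert_of_gt h, koszulSign_insert_of_lt hu h]
    ring
  · rw [koszulSign_insert_of_gt h, koszulSign_insert_of_lt hv h]
    ring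

end Sign

variable {K V : Type*} [Field K] [Fintype V] [DecidableEq V]

section Boundary

variable {M N : Type*} [AddCommGroup M] [Module (MvPolynomial V K) M]
  [AddCommGroup N] [Module (MvPolynomial V K) N]

/-- The Koszul differential for the variables `x_v`, on chains with coefficients in `M`; the value
of a chain at `S` is its coefficient at `⋀_{v ∈ S} e_v`. -/
noncomputable def koszulBoundary :
    (Finset V → M) →ₗ[MvPolynomial V K] (Finset V → M) where
  toFun c T := ∑ v ∈ Tᶜ, koszulSign v T • (X v : MvPolynomial V K) • c (insert v T)
  map_add' c c' := by
    ext1 T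
    simp [smul_add, Finset.sum_add_distrib]
  map_smul' p c := by
    ext1 T
    simp only [Pi.smul_apply, RingHom.id_apply, Finset.smul_sum]
    refine Finset.sum_congr rfl fun v _ => ?_
    rw [smul_comm (X v) p, smul_comm (koszulSign v T) p]

lemma koszulBoundary_apply (c : Finset V → M) (T : Finset V) :
    koszulBoundary (K := K) c T =
      ∑ v ∈ Tᶜ, koszulSign v T • (X v : MvPolynomial V K) • c (insert v T) :=
  rfl

lemma koszulBoundary_koszulBoundary (c : Finset V → M) :
    koszulBoundary (K := K) (koszulBoundary (K := K) c) = 0 := by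
  ext1 T
  simp only [koszulBoundary_apply, Finset.smul_sum]
  rw [Finset.sum_sigma', Pi.zero_apply]
  refine Finset.sum_involution (fun x _ => ⟨x.2, x.1⟩) ?_ ?_ ?_ ?_
  · rintro ⟨v, w⟩ h
    simp only [Finset.mem_sigma, Finset.mem_compl, Finset.mem_insert, not_or] at h
    obtain ⟨hv, hwv, hw⟩ := h
    simp only
    rw [Finset.insert_comm v w T, smul_comm (X v) (koszulSign w (insert v T)),
      smul_comm (X w) (koszulSign v (insert w T)), smul_comm (X v) (X w), smul_smul,
      koszulSign_mul_insert hw hv hwv, neg_smul, mul_smul, neg_add_cancel]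
  · rintro ⟨v, w⟩ h _ heq
    simp only [Finset.mem_sigma, Finset.mem_compl, Finset.mem_insert, not_or] at h
    simp only [Sigma.mk.injEq] at heq
    exact h.2.1 heq.1
  · rintro ⟨v, w⟩ h
    simp only [Finset.mem_sigma, Finset.mem_compl, Finset.mem_insert, not_or] at h ⊢
    exact ⟨h.2.2, Ne.symm h.2.1, h.1⟩
  · rintro ⟨v, w⟩ _
    rfl

lemma koszulBoundary_comp (φ : M →ₗ[MvPolynomial V K] N) (c : Finset V → M) :
    koszulBoundary (K := K) (fun S => φ (c S)) = fun S => φ (koszulBoundary (K := K) c S) := by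
  ext1 T
  simp [koszulBoundary_apply, map_sum]

variable [Module K M] [IsScalarTower K (MvPolynomial V K) M]

/-- The Koszul cycles in homological degree `p` with coefficients in a vector space `A` inside
the module `M`. -/
noncomputable def koszulCycles (A : Submodule K M) (p : ℕ) : Submodule K (Finset V → M) where
  carrier := {c | (∀ S, c S ∈ A) ∧ (∀ S, S.card ≠ p → c S = 0) ∧ koszulBoundary (K := K) c = 0}
  zero_mem' := ⟨fun _ => A.zero_mem, fun _ _ => rfl, map_zero _⟩
  add_mem' := fun h h' => ⟨fun S => A.add_mem (h.1 S) (h'.1 S),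
    fun S hS => by simp [h.2.1 S hS, h'.2.1 S hS], by rw [map_add, h.2.2, h'.2.2, add_zero]⟩
  smul_mem' := fun r c h => ⟨fun S => A.smul_mem r (h.1 S),
    fun S hS => by simp [h.2.1 S hS], by
      rw [LinearMap.map_smul_of_tower, h.2.2, smul_zero]⟩

/-- In exterior degree `0` every chain is a cycle, since no set of the form `insert v T` is empty. A
cycle is just its value at `∅`. -/
lemma finrank_koszulCycles_zero (A : Submodule K M) :
    Module.finrank K (koszulCycles A 0 : Submodule K (Finset V → M)) = Module.finrank K A := by
  let f : (koszulCycles A 0 : Submodule K (Finset V → M)) →ₗ[K] A :=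
    ((LinearMap.proj (∅ : Finset V)).comp (koszulCycles A 0).subtype).codRestrict A
      fun c => c.2.1 ∅
  refine (LinearEquiv.ofBijective f ⟨?_, ?_⟩).finrank_eq
  · rw [← LinearMap.ker_eq_bot, LinearMap.ker_eq_bot']
    intro c hc
    ext1
    ext1 S
    by_cases hS : S.card = 0
    · rw [Finset.card_eq_zero.1 hS]
      exact congrArg Subtype.val hc
    · exact c.2.2.1 S hS
  · intro x
    refine ⟨⟨fun S => if S = ∅ then x else 0, ?_, ?_, ?_⟩, ?_⟩
    · intro S
      dsimp only
      split_ifs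
      exacts [x.2, A.zero_mem]
    · intro S hS
      exact if_neg fun h => hS (by rw [h, Finset.card_empty])
    · ext1 T
      simp [koszulBoundary_apply]
    · exact Subtype.ext (if_pos rfl : (if (∅ : Finset V) = ∅ then (x : M) else 0) = x)

end Boundary

/-! ### Exactness of the Koszul complex at linear coefficients -/

lemma coeff_koszulBoundary (z : Finset V → MvPolynomial V K) (T : Finset V)
    (m : V →₀ ℕ) : coeff m (koszulBoundary (K := K) z T) =
      ∑ v ∈ Tᶜ, koszulSign v T •
        (if v ∈ m.support then coeff (m - Finsupp.single v 1) (z (insert v T)) else 0) := by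
  rw [koszulBoundary_apply, coeff_sum]
  refine Finset.sum_congr rfl fun v _ => ?_
  rw [smul_eq_mul, ← coeff_X_mul']
  exact map_zsmul (coeffAddMonoidHom m) _ _

/-- For `v ∈ S`, the coefficient of `x_v` in the boundary at `S.erase v` is `± y S`, so `y` can be
recovered from its boundary. -/
lemma eq_zero_of_koszulBoundary_const {p : ℕ} {y : Finset V → K}
    (hy : ∀ S, S.card ≠ p + 1 → y S = 0)
    (h : koszulBoundary (K := K) (fun S => (C (y S) : MvPolynomial V K)) = 0) : y = 0 := by
  ext1 S
  by_cases hS : S.card = p + 1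
  · obtain ⟨v, hv⟩ := Finset.card_pos.1 (by rw [hS]; exact p.succ_pos)
    have h1 := congrArg (coeff (Finsupp.single v 1)) (congrFun h (S.erase v))
    rw [coeff_koszulBoundary, Finset.sum_eq_single v] at h1
    · rw [Finset.insert_erase hv] at h1
      have hs : koszulSign v (S.erase v) ≠ 0 := fun h0 => by
        simpa [h0] using koszulSign_mul_self v (S.erase v)
      rw [if_pos (by simp), tsub_self, coeff_zero_C, Pi.zero_apply, coeff_zero, zsmul_eq_mul] at h1
      have h2 := congrArg (fun t => (koszulSign v (S.erase v) : K) * t) h1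
      simp only [← mul_assoc, ← Int.cast_mul, koszulSign_mul_self] at h2
      simpa using h2
    · intro w _ hwv
      rw [if_neg, smul_zero]
      simpa [Finsupp.single_apply, eq_comm] using hwv
    · intro hn
      exact absurd (by simp) hn
  · exact hy S hS

lemma eq_sum_coeff_of_mem_gradedPart_one {p : MvPolynomial V K} (hp : p ∈ gradedPart K V 1) :
    p = ∑ v, C (coeff (Finsupp.single v 1) p) * X v := by
  ext m
  rw [coeff_sum]
  simp only [coeff_C_mul, coeff_X]
  by_cases hm : m.degree = 1
  · obtain ⟨v, rfl⟩ : m ∈ Set.range fun v : V => Finsupp.single v 1 := by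
      rwa [Finsupp.range_single_one]
    rw [Finset.sum_eq_single v]
    · simp
    · intro w _ hw
      simp [Finsupp.single_left_inj, hw]
    · simp
  · rw [Finset.sum_eq_zero]
    · by_contra hne
      exact hm (by exact_mod_cast hp m hne)
    · intro v _
      rw [if_neg, mul_zero]
      rintro rfl
      simp at hm

/-- The primitive is written down explicitly, which avoids dividing by integers and so works in
every characteristic: `y U` is, up to sign, the coefficient of `x_u` in `z (U.erase u)` for any `u ∈
U`. The cycle condition, read on the quadratic monomials, shows that the choice of `u` does not
matter. -/
lemma exists_koszulBoundary_eq {z : Finset V → MvPolynomial V K}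
    (hz : ∀ S, z S ∈ gradedPart K V 1) (h : koszulBoundary (K := K) z = 0) {p : ℕ}
    (hp : ∀ S, S.card ≠ p → z S = 0) :
    ∃ y : Finset V → K, (∀ S, S.card ≠ p + 1 → y S = 0) ∧
      koszulBoundary (K := K) (fun S => (C (y S) : MvPolynomial V K)) = z := by
  have hcoef : ∀ (T : Finset V) (m : V →₀ ℕ), ∑ v ∈ Tᶜ, koszulSign v T •
      (if v ∈ m.support then coeff (m - Finsupp.single v 1) (z (insert v T)) else 0) = 0 := by
    intro T m
    rw [← coeff_koszulBoundary, h]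
    simp
  -- Only one term of the boundary at `S.erase v` can contribute to `x_v ^ 2`.
  have hin : ∀ (S : Finset V) (v : V), v ∈ S → coeff (Finsupp.single v 1) (z S) = 0 := by
    intro S v hv
    have h1 := hcoef (S.erase v) (Finsupp.single v 1 + Finsupp.single v 1)
    rw [Finset.sum_eq_single v] at h1
    · rw [Finset.insert_erase hv, if_pos (by simp), add_tsub_cancel_right, zsmul_eq_mul] at h1
      have h2 := congrArg (fun t => (koszulSign v (S.erase v) : K) * t) h1
      simp only [← mul_assoc, ← Int.cast_mul, koszulSign_mul_self] at h2
      simpa using h2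
    · intro w _ hwv
      rw [if_neg, smul_zero]
      simpa [Finsupp.single_apply, eq_comm] using hwv
    · intro hn
      exact absurd (by simp) hn
  -- The coefficient of `x_u x_v` in the boundary at `T` receives exactly these two terms.
  have hpair : ∀ (T : Finset V) (u v : V), u ∉ T → v ∉ T → u ≠ v →
      koszulSign u T • coeff (Finsupp.single v 1) (z (insert u T)) +
        koszulSign v T • coeff (Finsupp.single u 1) (z (insert v T)) = 0 := by
    intro T u v hu hv huv
    have h1 := hcoef T (Finsupp.single u 1 + Finsupp.single v 1)
    rw [← Finset.sum_subset (s₁ := {u, v})] at h1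
    · rw [Finset.sum_pair huv, if_pos (by simp), if_pos (by simp), add_tsub_cancel_right,
        add_tsub_cancel_left] at h1
      exact h1
    · intro w hw
      rcases Finset.mem_insert.1 hw with rfl | hw
      · simpa using hu
      · rw [Finset.mem_singleton.1 hw]
        simpa using hv
    · intro w _ hw
      simp only [Finset.mem_insert, Finset.mem_singleton, not_or] at hw
      rw [if_neg, smul_zero]
      simp [Ne.symm hw.1, Ne.symm hw.2]
  have hindep : ∀ (U : Finset V) (u v : V), u ∈ U → v ∈ U →
      koszulSign u (U.erase u) • coeff (Finsupp.single u 1) (z (U.erase u)) =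
        koszulSign v (U.erase v) • coeff (Finsupp.single v 1) (z (U.erase v)) := by
    intro U u v hu hv
    by_cases huv : u = v
    · rw [huv]
    set T := (U.erase u).erase v with hT
    have hu' : u ∉ T := by simp [hT]
    have hv' : v ∉ T := by simp [hT]
    have e1 : U.erase u = insert v T := (Finset.insert_erase (by simp [hv, Ne.symm huv])).symm
    have e2 : U.erase v = insert u T := by
      rw [hT, Finset.erase_right_comm, Finset.insert_erase (by simp [hu, huv])]
    rw [e1, e2]
    have h1 := hpair T u v hu' hv' huv
    have h2 := koszulSign_mul_insert hu' hv' huv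
    have h3 : koszulSign u (insert v T) = -(koszulSign u T * koszulSign v T) *
        koszulSign v (insert u T) := by
      linear_combination koszulSign v T * h2 - koszulSign u (insert v T) * koszulSign_mul_self v T
    have h4 : koszulSign v T • coeff (Finsupp.single u 1) (z (insert v T)) =
        -(koszulSign u T • coeff (Finsupp.single v 1) (z (insert u T))) :=
      eq_neg_of_add_eq_zero_right h1
    rw [h3, show -(koszulSign u T * koszulSign v T) * koszulSign v (insert u T) =
      -(koszulSign u T * koszulSign v (insert u T)) * koszulSign v T by ring, mul_smul, h4,
      smul_neg, neg_smul, neg_neg, smul_smul,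
      show koszulSign u T * koszulSign v (insert u T) * koszulSign u T =
        koszulSign u T * koszulSign u T * koszulSign v (insert u T) by ring,
      koszulSign_mul_self, one_mul]
  -- The default value `0` at `∅` is harmless: `y` is to live on sets with `p + 1` elements.
  let y : Finset V → K := fun U => if hU : U.Nonempty then
    koszulSign hU.choose (U.erase hU.choose) •
      coeff (Finsupp.single hU.choose 1) (z (U.erase hU.choose)) else 0
  have hy : ∀ (U : Finset V) (u : V), u ∈ U →
      y U = koszulSign u (U.erase u) • coeff (Finsupp.single u 1) (z (U.erase u)) := by
    intro U u hu
    have hU : U.Nonempty := ⟨u, hu⟩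
    simp only [y, dif_pos hU]
    exact hindep U _ _ hU.choose_spec hu
  refine ⟨y, ?_, ?_⟩
  · intro S hS
    rcases S.eq_empty_or_nonempty with rfl | ⟨u, hu⟩
    · simp [y]
    · rw [hy S u hu, hp, coeff_zero, smul_zero]
      rw [Finset.card_erase_of_mem hu]
      have := Finset.card_pos.2 ⟨u, hu⟩
      lia
  · ext1 T
    rw [koszulBoundary_apply]
    conv_rhs => rw [eq_sum_coeff_of_mem_gradedPart_one (hz T)]
    rw [← Finset.sum_subset (Finset.subset_univ Tᶜ)]
    · refine Finset.sum_congr rfl fun v hv => ?_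
      have hv : v ∉ T := by simpa using hv
      rw [hy (insert v T) v (Finset.mem_insert_self v T), Finset.erase_insert hv, smul_eq_mul,
        map_zsmul, mul_smul_comm, smul_smul, koszulSign_mul_self, one_smul, mul_comm]
    · intro v _ hv
      rw [hin T v (by simpa using hv), C_0, zero_mul]

end MvPolynomial

/-! ### The linear strand of a minimal resolution -/

namespace MvPolynomial

section Shift

variable {K V : Type*} [Field K] {ι κ : Type*} [Fintype ι] [DecidableEq ι]
  {a : ι → ℤ} {b : κ → ℤ}
  {φ : (ι → MvPolynomial V K) →ₗ[MvPolynomial V K] (κ → MvPolynomial V K)}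

/-- Both sides measure the component of degree `e` of the source: `φ` is injective on it, and it
consists of constant vectors supported on the generators of degree exactly `e`. -/
lemma finrank_range_inf_gradedVec
    (hφ : ∀ k l, φ (Pi.single k 1) l ∈ gradedPart K V (a k - b l))
    (hker : ∀ f ∈ LinearMap.ker φ, ∀ k, coeff 0 (f k) = 0) {e : ℤ} (ha : ∀ k, e ≤ a k) :
    Module.finrank K ↥((LinearMap.range φ).restrictScalars K ⊓ gradedVec b e) =
      (Finset.univ.filter fun k => a k = e).card := by
  let f : (gradedVec a e : Submodule K (ι → MvPolynomial V K)) →ₗ[K]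
      ↥((LinearMap.range φ).restrictScalars K ⊓ gradedVec b e) :=
    ((φ.restrictScalars K).comp (gradedVec a e).subtype).codRestrict _
      fun x => ⟨⟨_, rfl⟩, map_mem_gradedVec hφ x.2⟩
  have hf : Function.Bijective f := by
    constructor
    · rw [← LinearMap.ker_eq_bot, LinearMap.ker_eq_bot']
      intro x hx
      exact Subtype.ext (eq_zero_of_mem_gradedVec hker ha x.2 (congrArg Subtype.val hx))
    · rintro ⟨y, hy, hy'⟩
      obtain ⟨x, hx, rfl⟩ := exists_mem_gradedVec_of_mem_range hφ hy' hy
      exact ⟨⟨x, hx⟩, rfl⟩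
  let g : (gradedVec a e : Submodule K (ι → MvPolynomial V K)) →ₗ[K] ({k // a k = e} → K) :=
    LinearMap.pi fun k => (lcoeff K 0).comp ((LinearMap.proj k.1).comp (gradedVec a e).subtype)
  have hg : Function.Bijective g := by
    constructor
    · rw [← LinearMap.ker_eq_bot, LinearMap.ker_eq_bot']
      intro x hx
      ext1
      ext1 k
      refine eq_zero_of_mem_gradedPart (sub_nonpos.2 (ha k)) (x.2 k) ?_
      by_cases hk : a k = e
      · exact congrFun hx ⟨k, hk⟩
      · exact coeff_zero_of_mem_gradedPart (sub_ne_zero.2 (Ne.symm hk)) (x.2 k)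
    · intro y
      refine ⟨⟨fun k => if hk : a k = e then C (y ⟨k, hk⟩) else 0, fun k => ?_⟩, ?_⟩
      · dsimp only
        split_ifs with hk
        · rw [hk, sub_self]
          exact C_mem_gradedPart _
        · exact Submodule.zero_mem _
      · ext1 k
        simp [g, k.2, lcoeff_apply]
  rw [← (LinearEquiv.ofBijective f hf).finrank_eq, (LinearEquiv.ofBijective g hg).finrank_eq,
    Module.finrank_pi, Fintype.card_subtype]

variable [Fintype V] [DecidableEq V]

omit [Fintype ι] [DecidableEq ι] in
lemma koszulBoundary_apply_apply (c : Finset V → ι → MvPolynomial V K) (T : Finset V) (k : ι) :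
    koszulBoundary (K := K) c T k = koszulBoundary (K := K) (fun S => c S k) T :=
  (congrFun (koszulBoundary_comp (LinearMap.proj k) c) T).symm

omit [Fintype ι] [DecidableEq ι] in
lemma koszulBoundary_mem_gradedVec {e : ℤ} {c : Finset V → ι → MvPolynomial V K}
    (hc : ∀ S, c S ∈ gradedVec a e) (T : Finset V) :
    koszulBoundary (K := K) c T ∈ gradedVec a (e + 1) := by
  rw [koszulBoundary_apply]
  refine Submodule.sum_mem _ fun v _ => ?_
  refine zsmul_mem ?_ _
  rw [add_comm]
  exact smul_mem_gradedVec (X_mem_gradedPart v) (hc _)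

lemma koszulBoundary_eq_zero_of_card {M : Type*} [AddCommGroup M] [Module (MvPolynomial V K) M]
    {p : ℕ} {c : Finset V → M} (hc : ∀ S, S.card ≠ p + 1 → c S = 0) (T : Finset V)
    (hT : T.card ≠ p) : koszulBoundary (K := K) c T = 0 := by
  rw [koszulBoundary_apply]
  refine Finset.sum_eq_zero fun v hv => ?_
  rw [hc, smul_zero, smul_zero]
  rw [Finset.card_insert_of_notMem (by simpa using hv)]
  lia

/-- The chains with coefficients in a free module which a map to another free module turns into
cycles. -/
noncomputable def koszulLifts
    (φ : (ι → MvPolynomial V K) →ₗ[MvPolynomial V K] (κ → MvPolynomial V K)) (a : ι → ℤ) (e : ℤ)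
    (p : ℕ) : Submodule K (Finset V → ι → MvPolynomial V K) where
  carrier := {y | (∀ S, y S ∈ gradedVec a e) ∧ (∀ S, S.card ≠ p + 1 → y S = 0) ∧
    (fun S => φ (koszulBoundary (K := K) y S)) = 0}
  zero_mem' := ⟨fun _ => Submodule.zero_mem _, fun _ _ => rfl, by simp; rfl⟩
  add_mem' := fun h h' => ⟨fun S => Submodule.add_mem _ (h.1 S) (h'.1 S),
    fun S hS => by simp [h.2.1 S hS, h'.2.1 S hS], by
      ext1 S
      rw [map_add, Pi.add_apply, map_add]
      exact (congrArg₂ (· + ·) (congrFun h.2.2 S) (congrFun h'.2.2 S)).trans (add_zero _)⟩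
  smul_mem' := fun r c h => ⟨fun S => Submodule.smul_mem _ r (h.1 S),
    fun S hS => by simp [h.2.1 S hS], by
      ext1 S
      rw [LinearMap.map_smul_of_tower, Pi.smul_apply, LinearMap.map_smul_of_tower]
      exact (congrArg (r • ·) (congrFun h.2.2 S)).trans (smul_zero _)⟩

/-- Both spaces are isomorphic to `koszulLifts φ a e p`, a space of chains with constant entries.
Applying `φ` to such a chain gives a cycle over the image, and taking its Koszul boundary gives a
cycle over the kernel. The first map is bijective by minimality of `φ`, the second by exactness of
the Koszul complex at linear coefficients. -/
lemma finrank_koszulCycles_range_succ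
    (hφ : ∀ k l, φ (Pi.single k 1) l ∈ gradedPart K V (a k - b l))
    (hker : ∀ f ∈ LinearMap.ker φ, ∀ k, coeff 0 (f k) = 0) {e : ℤ} (ha : ∀ k, e ≤ a k) (p : ℕ) :
    Module.finrank K (koszulCycles ((LinearMap.range φ).restrictScalars K ⊓ gradedVec b e)
        (p + 1) : Submodule K (Finset V → κ → MvPolynomial V K)) =
      Module.finrank K (koszulCycles ((LinearMap.ker φ).restrictScalars K ⊓ gradedVec a (e + 1))
        p : Submodule K (Finset V → ι → MvPolynomial V K)) := by
  let f : koszulLifts φ a e p →ₗ[K]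
      (koszulCycles ((LinearMap.range φ).restrictScalars K ⊓ gradedVec b e)
        (p + 1) : Submodule K (Finset V → κ → MvPolynomial V K)) :=
    (((φ.restrictScalars K).compLeft (Finset V)).comp (koszulLifts φ a e p).subtype).codRestrict _
      fun y => ⟨fun S => ⟨⟨y.1 S, rfl⟩, map_mem_gradedVec hφ (y.2.1 S)⟩,
        fun S hS => (congrArg φ (y.2.2.1 S hS)).trans (map_zero φ),
        (koszulBoundary_comp φ y.1).trans y.2.2.2⟩
  let g : koszulLifts φ a e p →ₗ[K]
      (koszulCycles ((LinearMap.ker φ).restrictScalars K ⊓ gradedVec a (e + 1))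
        p : Submodule K (Finset V → ι → MvPolynomial V K)) :=
    ((koszulBoundary.restrictScalars K).comp (koszulLifts φ a e p).subtype).codRestrict _
      fun y => ⟨fun S => ⟨congrFun y.2.2.2 S, koszulBoundary_mem_gradedVec y.2.1 S⟩,
        koszulBoundary_eq_zero_of_card y.2.2.1, koszulBoundary_koszulBoundary _⟩
  have hf : Function.Bijective f := by
    constructor
    · rw [← LinearMap.ker_eq_bot, LinearMap.ker_eq_bot']
      intro y hy
      ext1
      ext1 S
      exact eq_zero_of_mem_gradedVec hker ha (y.2.1 S) (congrFun (congrArg Subtype.val hy) S)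
    · rintro ⟨z, hz, hz', hz''⟩
      have hex : ∀ S, ∃ x ∈ gradedVec a e, φ x = z S := fun S =>
        exists_mem_gradedVec_of_mem_range hφ (hz S).2 (hz S).1
      choose y hy hyz using hex
      have hyz' : (fun S => φ (y S)) = z := by
        ext1 S
        exact hyz S
      refine ⟨⟨y, hy, fun S hS => ?_, ?_⟩, Subtype.ext hyz'⟩
      · exact eq_zero_of_mem_gradedVec hker ha (hy S) (by rw [hyz, hz' S hS])
      · rw [← koszulBoundary_comp, hyz', hz'']
  have hg : Function.Bijective g := by
    constructor
    · rw [← LinearMap.ker_eq_bot, LinearMap.ker_eq_bot']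
      intro y hy
      have hy0 : koszulBoundary (K := K) y.1 = 0 := congrArg Subtype.val hy
      have hC : ∀ S k, y.1 S k = C (coeff 0 (y.1 S k)) := fun S k =>
        eq_C_of_mem_gradedPart (sub_nonpos.2 (ha k)) (y.2.1 S k)
      have hk : ∀ k, (fun S => coeff 0 (y.1 S k)) = 0 := fun k => by
        refine eq_zero_of_koszulBoundary_const (p := p) (fun S hS => ?_) ?_
        · rw [y.2.2.1 S hS, Pi.zero_apply, coeff_zero]
        · simp only [← hC]
          ext1 T
          rw [← koszulBoundary_apply_apply, hy0]
          rfl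
      ext1
      ext1 S
      ext1 k
      rw [hC, congrFun (hk k) S]
      exact C_0
    · rintro ⟨z, hz, hz', hz''⟩
      -- Coordinates are treated separately. If `a k = e`, the entries are linear forms and
      -- exactness applies; if `a k > e`, they are constants, which vanish because kernel elements
      -- have no constant terms.
      have hex : ∀ k, ∃ y : Finset V → K, (∀ S, S.card ≠ p + 1 → y S = 0) ∧
          (a k ≠ e → y = 0) ∧
          koszulBoundary (K := K) (fun S => (C (y S) : MvPolynomial V K)) = fun S => z S k := by
        intro k
        by_cases hk : a k = e
        · obtain ⟨y, hy, hyz⟩ := exists_koszulBoundary_eq (z := fun S => z S k) (p := p)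
            (fun S => by
              have := (hz S).2 k
              rwa [hk, add_sub_cancel_left] at this)
            (by
              ext1 T
              rw [← koszulBoundary_apply_apply, hz'']
              rfl)
            (fun S hS => by rw [hz' S hS, Pi.zero_apply])
          exact ⟨y, hy, fun h => absurd hk h, hyz⟩
        · refine ⟨0, fun _ _ => rfl, fun _ => rfl, ?_⟩
          have hzk : ∀ S, z S k = 0 := fun S =>
            eq_zero_of_mem_gradedPart (by have := lt_of_le_of_ne (ha k) (Ne.symm hk); lia)
              ((hz S).2 k) (hker _ (hz S).1 k)
          simp only [hzk, Pi.zero_apply, C_0]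
          exact map_zero _
      choose y hy hy0 hyz using hex
      have hb : koszulBoundary (K := K) (fun S k => (C (y k S) : MvPolynomial V K)) = z := by
        ext1 T
        ext1 k
        rw [koszulBoundary_apply_apply, hyz]
      refine ⟨⟨fun S k => C (y k S), fun S k => ?_, fun S hS => ?_, ?_⟩, Subtype.ext hb⟩
      · by_cases hk : a k = e
        · rw [hk, sub_self]
          exact C_mem_gradedPart _
        · simp only [hy0 k hk, Pi.zero_apply, C_0]
          exact Submodule.zero_mem _
      · ext1 k
        simp [hy k S hS]
      · rw [hb]
        ext1 S
        exact (hz S).1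
  exact (LinearEquiv.ofBijective f hf).finrank_eq.symm.trans
    (LinearEquiv.ofBijective g hg).finrank_eq

end Shift

end MvPolynomial

namespace MinimalGradedFreeResolution

open MvPolynomial

variable {K V M : Type*} [Field K] [AddCommGroup M] [Module K M] [Module (MvPolynomial V K) M]
  {𝓜 : ℤ → Submodule K M} (F : MinimalGradedFreeResolution (σ := V) 𝓜)

lemma coeff_zero_of_mem_range (i : ℕ) {f : Fin (F.rank i) → MvPolynomial V K}
    (hf : f ∈ LinearMap.range (F.d i)) (k : Fin (F.rank i)) : coeff 0 (f k) = 0 := by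
  obtain ⟨g, rfl⟩ := hf
  rw [← mem_span_range_X, LinearMap.pi_apply_eq_sum_univ (F.d i), Finset.sum_apply]
  refine Submodule.sum_mem _ fun l _ => ?_
  have h : (fun j => if l = j then (1 : MvPolynomial V K) else 0) = Pi.single l 1 := by
    ext1 j; simp [Pi.single_apply, eq_comm]
  rw [h]
  exact Ideal.mul_mem_left _ _ (F.minimal i l k)

lemma ker_d (i : ℕ) : LinearMap.ker (F.d i) = LinearMap.range (F.d (i + 1)) :=
  (LinearMap.exact_iff.1 (F.exact_succ i))

lemma ker_ε : LinearMap.ker F.ε = LinearMap.range (F.d 0) :=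
  (LinearMap.exact_iff.1 F.exact_zero)

lemma coeff_zero_of_mem_ker_d (i : ℕ) (f : Fin (F.rank (i + 1)) → MvPolynomial V K)
    (hf : f ∈ LinearMap.ker (F.d i)) (k : Fin (F.rank (i + 1))) : coeff 0 (f k) = 0 :=
  F.coeff_zero_of_mem_range (i + 1) (F.ker_d i ▸ hf) k

/-- A basis vector of degree below `e` would map to zero, but kernel elements have no constant
terms. -/
lemma le_deg_succ (i : ℕ) {e : ℤ}
    (h : ∀ j < e, ∀ f ∈ LinearMap.range (F.d i), f ∈ gradedVec (F.deg i) j → f = 0)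
    (k : Fin (F.rank (i + 1))) : e ≤ F.deg (i + 1) k := by
  by_contra! hlt
  have h1 : Pi.single k 1 ∈ LinearMap.ker (F.d i) :=
    h _ hlt _ ⟨_, rfl⟩ fun l => F.d_homogeneous i k l
  simpa using F.coeff_zero_of_mem_ker_d i _ h1 k

lemma eq_zero_of_mem_range_of_lt (i : ℕ) {e j : ℤ} (h : ∀ k, e ≤ F.deg i k) (hj : j ≤ e)
    {f : Fin (F.rank i) → MvPolynomial V K} (hf : f ∈ LinearMap.range (F.d i))
    (hfj : f ∈ gradedVec (F.deg i) j) : f = 0 := by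
  ext1 k
  exact eq_zero_of_mem_gradedPart (sub_nonpos.2 (hj.trans (h k))) (hfj k)
    (F.coeff_zero_of_mem_range i hf k)

/-- Degrees rise by at least one at each step, because by minimality the image of each differential
vanishes up to the lowest possible generator degree of its target. -/
lemma le_deg {e : ℤ}
    (h : ∀ j < e, ∀ f ∈ LinearMap.range (F.d 0), f ∈ gradedVec (F.deg 0) j → f = 0)
    (i : ℕ) (k : Fin (F.rank (i + 1))) : e + i ≤ F.deg (i + 1) k := by
  induction i with
  | zero => simpa using F.le_deg_succ 0 h k
  | succ i ih =>
    refine F.le_deg_succ (i + 1) (fun j hj f hf hfj => ?_) k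
    exact F.eq_zero_of_mem_range_of_lt (i + 1) ih (by push_cast at hj; lia) hf hfj

/-- If the syzygies of a graded module are zero in degrees below `e`, then the Betti numbers along
the linear strand starting there are the dimensions of the Koszul cycles with coefficients in the
syzygies of degree `e`. -/
theorem betti_eq_finrank_koszulCycles [Fintype V] [DecidableEq V] {e : ℤ}
    (h : ∀ j < e, ∀ f ∈ LinearMap.range (F.d 0), f ∈ gradedVec (F.deg 0) j → f = 0) (n : ℕ) :
    F.betti (n + 1) (e + n) = Module.finrank K
      (koszulCycles ((LinearMap.range (F.d 0)).restrictScalars K ⊓ gradedVec (F.deg 0) e) n :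
        Submodule K (Finset V → Fin (F.rank 0) → MvPolynomial V K)) := by
  -- Each use of the shift lowers the exterior degree by one and raises both the position in the
  -- resolution and the internal degree by one.
  have key : ∀ p i : ℕ, Module.finrank K
      (koszulCycles ((LinearMap.range (F.d (i + p))).restrictScalars K ⊓
        gradedVec (F.deg (i + p)) (e + (i + p : ℕ))) 0 :
        Submodule K (Finset V → Fin (F.rank (i + p)) → MvPolynomial V K)) = Module.finrank K
      (koszulCycles ((LinearMap.range (F.d i)).restrictScalars K ⊓
        gradedVec (F.deg i) (e + i)) p :
        Submodule K (Finset V → Fin (F.rank i) → MvPolynomial V K)) := by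
    intro p
    induction p with
    | zero => intro i; rfl
    | succ p ih =>
      intro i
      rw [finrank_koszulCycles_range_succ (F.d_homogeneous i) (F.coeff_zero_of_mem_ker_d i)
        (F.le_deg h i) p, F.ker_d, ← Nat.add_right_comm i 1 p |>.trans (Nat.add_assoc i p 1), ih]
      rw [Nat.cast_succ, ← add_assoc]
  have h0 := key n 0
  rw [Nat.zero_add, finrank_koszulCycles_zero, finrank_range_inf_gradedVec (F.d_homogeneous n)
    (F.coeff_zero_of_mem_ker_d n) (F.le_deg h n)] at h0
  rw [Nat.cast_zero, add_zero] at h0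
  rw [betti, h0]

end MinimalGradedFreeResolution

/-! ### Existence of minimal graded free resolutions -/

namespace MvPolynomial

variable {K σ ι : Type*} [Field K]

lemma exists_finite_homogeneous_generators [Finite σ] [Fintype ι] {b : ι → ℤ}
    {N : Submodule (MvPolynomial σ K) (ι → MvPolynomial σ K)}
    (hN : ∀ f ∈ N, ∀ j, vecProj b j f ∈ N) :
    ∃ (r : ℕ) (a : Fin r → ℤ) (g : Fin r → ι → MvPolynomial σ K),
      (∀ k, g k ∈ gradedVec b (a k)) ∧ Submodule.span (MvPolynomial σ K) (Set.range g) = N := by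
  classical
  obtain ⟨S, hS⟩ := (isNoetherian_def.1 (inferInstance :
    IsNoetherian (MvPolynomial σ K) (ι → MvPolynomial σ K))) N
  choose J hJ using fun f : ι → MvPolynomial σ K => exists_sum_vecProj b f
  let T : Finset (ι → MvPolynomial σ K) := S.biUnion fun f => (J f).image fun j => vecProj b j f
  have hT : ∀ g ∈ T, ∃ j, g ∈ gradedVec b j := by
    intro g hg
    obtain ⟨f, _, hg⟩ := Finset.mem_biUnion.1 hg
    obtain ⟨j, _, rfl⟩ := Finset.mem_image.1 hg
    exact ⟨j, vecProj_mem _ _ _⟩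
  choose a ha using fun k : Fin T.card => hT _ (T.equivFin.symm k).2
  refine ⟨T.card, a, fun k => (T.equivFin.symm k).1, ha, ?_⟩
  have hrange : Set.range (fun k => (T.equivFin.symm k).1) = (T : Set (ι → MvPolynomial σ K)) := by
    ext g
    constructor
    · rintro ⟨k, rfl⟩
      exact (T.equivFin.symm k).2
    · intro hg
      exact ⟨T.equivFin ⟨g, hg⟩, by simp⟩
  rw [hrange]
  apply le_antisymm
  · rw [Submodule.span_le]
    intro g hg
    obtain ⟨f, hf, hg⟩ := Finset.mem_biUnion.1 hg
    obtain ⟨j, _, rfl⟩ := Finset.mem_image.1 hg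
    exact hN _ (hS ▸ Submodule.subset_span hf) _
  · rw [← hS, Submodule.span_le]
    intro f hf
    rw [← hJ f]
    refine Submodule.sum_mem _ fun j hj => Submodule.subset_span ?_
    exact Finset.mem_biUnion.2 ⟨f, hf, Finset.mem_image_of_mem _ hj⟩

/-- A homogeneous generating family with as few members as possible works. If a relation had a
nonzero constant term at `k`, its part of degree `a k` would express `g k` through the other
generators. -/
lemma exists_minimal_cover [Finite σ] [Fintype ι] {b : ι → ℤ}
    {N : Submodule (MvPolynomial σ K) (ι → MvPolynomial σ K)}
    (hN : ∀ f ∈ N, ∀ j, vecProj b j f ∈ N) :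
    ∃ (r : ℕ) (a : Fin r → ℤ)
      (φ : (Fin r → MvPolynomial σ K) →ₗ[MvPolynomial σ K] (ι → MvPolynomial σ K)),
      (∀ k l, φ (Pi.single k 1) l ∈ gradedPart K σ (a k - b l)) ∧ LinearMap.range φ = N ∧
        ∀ f ∈ LinearMap.ker φ, ∀ k, coeff 0 (f k) = 0 := by
  classical
  have hex := exists_finite_homogeneous_generators hN
  obtain ⟨a, g, hg, hspan⟩ := Nat.find_spec hex
  have hmin : ∀ m < Nat.find hex, ¬ _ := fun m hm => Nat.find_min hex hm
  generalize Nat.find hex = r at a g hmin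
  let φ := Fintype.linearCombination (MvPolynomial σ K) g
  have hφ : ∀ k l, φ (Pi.single k 1) l ∈ gradedPart K σ (a k - b l) := fun k l => by
    rw [Fintype.linearCombination_apply_single, one_smul]
    exact hg k l
  refine ⟨r, a, φ, hφ, ?_, ?_⟩
  · rw [← hspan, Fintype.range_linearCombination]
  · intro f hf k
    by_contra hk
    obtain ⟨r, rfl⟩ : ∃ r', r = r' + 1 := Nat.exists_eq_succ_of_ne_zero k.pos.ne'
    refine hmin r r.lt_succ_self ⟨a ∘ k.succAbove, g ∘ k.succAbove, fun l => hg _, ?_⟩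
    apply le_antisymm
    · rw [← hspan]
      exact Submodule.span_mono (Set.range_comp_subset_range _ _)
    · rw [← hspan, Submodule.span_le]
      have hgk : g k ∈ Submodule.span (MvPolynomial σ K) (Set.range (g ∘ k.succAbove)) := by
        have h0 : φ (vecProj a (a k) f) = 0 := by
          rw [map_vecProj hφ, LinearMap.mem_ker.1 hf, map_zero]
        have hc : vecProj a (a k) f k = C (coeff 0 (f k)) := by
          rw [vecProj_apply, eq_C_of_mem_gradedPart (sub_self (a k)).le (gradedProj_mem _ _),
            coeff_gradedProj]
          simp
        rw [Fintype.linearCombination_apply, Fin.sum_univ_succAbove _ k, hc] at h0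
        have h1 : g k =
            (C (coeff 0 (f k))⁻¹ : MvPolynomial σ K) • ((C (coeff 0 (f k)) : MvPolynomial σ K) • g k) := by
          rw [smul_smul, ← C_mul, inv_mul_cancel₀ hk, C_1, one_smul]
        rw [h1, eq_neg_of_add_eq_zero_left h0]
        refine Submodule.smul_mem _ _ (Submodule.neg_mem _ (Submodule.sum_mem _ fun l _ => ?_))
        exact Submodule.smul_mem _ _ (Submodule.subset_span ⟨l, rfl⟩)
      rintro _ ⟨l, rfl⟩
      rcases Fin.eq_self_or_eq_succAbove k l with rfl | ⟨l, rfl⟩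
      · exact hgk
      · exact Submodule.subset_span ⟨l, rfl⟩

/-- A graded submodule of a free module of finite rank, contained in the multiples of the maximal
ideal. -/
structure GradedSyzygies (K σ : Type*) [Field K] where
  /-- the rank of the free module -/
  rank : ℕ
  /-- the degrees of the basis elements -/
  deg : Fin rank → ℤ
  /-- the submodule -/
  module : Submodule (MvPolynomial σ K) (Fin rank → MvPolynomial σ K)
  vecProj_mem : ∀ f ∈ module, ∀ j, vecProj deg j f ∈ module
  coeff_zero : ∀ f ∈ module, ∀ k, coeff 0 (f k) = 0

namespace GradedSyzygies

variable [Finite σ] (S : GradedSyzygies K σ)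

/-- The rank of a minimal cover. -/
noncomputable def coverRank : ℕ := (exists_minimal_cover S.vecProj_mem).choose

/-- The degrees of a minimal cover. -/
noncomputable def coverDeg : Fin S.coverRank → ℤ :=
  (exists_minimal_cover S.vecProj_mem).choose_spec.choose

/-- A minimal cover by a free module. -/
noncomputable def cover : (Fin S.coverRank → MvPolynomial σ K) →ₗ[MvPolynomial σ K]
    (Fin S.rank → MvPolynomial σ K) :=
  (exists_minimal_cover S.vecProj_mem).choose_spec.choose_spec.choose

lemma cover_homogeneous (k : Fin S.coverRank) (l : Fin S.rank) :
    S.cover (Pi.single k 1) l ∈ gradedPart K σ (S.coverDeg k - S.deg l) :=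
  (exists_minimal_cover S.vecProj_mem).choose_spec.choose_spec.choose_spec.1 k l

lemma range_cover : LinearMap.range S.cover = S.module :=
  (exists_minimal_cover S.vecProj_mem).choose_spec.choose_spec.choose_spec.2.1

/-- The kernel of a minimal cover. -/
noncomputable def next : GradedSyzygies K σ where
  rank := S.coverRank
  deg := S.coverDeg
  module := LinearMap.ker S.cover
  vecProj_mem := fun f hf j => by
    rw [LinearMap.mem_ker, map_vecProj S.cover_homogeneous, LinearMap.mem_ker.1 hf, map_zero]
  coeff_zero := (exists_minimal_cover S.vecProj_mem).choose_spec.choose_spec.choose_spec.2.2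

lemma cover_eq_zero_iff (y : Fin S.coverRank → MvPolynomial σ K) :
    S.cover y = 0 ↔ ∃ x, S.next.cover x = y := by
  have h := SetLike.ext_iff.1 S.next.range_cover y
  exact h.symm

/-- The iterated syzygies. -/
noncomputable def iter : ℕ → GradedSyzygies K σ
  | 0 => S
  | n + 1 => (iter n).next

end GradedSyzygies

/-- Start with `R → R/I`, whose kernel is graded and has no constant terms by the two hypotheses,
and cover successive kernels minimally. -/
theorem nonempty_minimalGradedFreeResolution [Finite σ] {I : Ideal (MvPolynomial σ K)}
    (hI : ∀ f ∈ I, ∀ j, gradedProj j f ∈ I) (h0 : ∀ f ∈ I, coeff 0 f = 0) :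
    Nonempty (MinimalGradedFreeResolution (σ := σ) (quotientGradedPart I)) := by
  let ε : (Fin 1 → MvPolynomial σ K) →ₗ[MvPolynomial σ K] (MvPolynomial σ K ⧸ I) :=
    (Submodule.mkQ I).comp (LinearMap.proj 0)
  have hε : ∀ f, f ∈ LinearMap.ker ε ↔ f 0 ∈ I := fun f => by
    rw [LinearMap.mem_ker]
    exact Submodule.Quotient.mk_eq_zero I
  let S : GradedSyzygies K σ :=
    { rank := 1
      deg := 0
      module := LinearMap.ker ε
      vecProj_mem := fun f hf j => (hε _).2 (hI _ ((hε f).1 hf) _)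
      coeff_zero := fun f hf k => by
        rw [Subsingleton.elim k 0]
        exact h0 _ ((hε f).1 hf) }
  refine ⟨
    { rank := fun i => (S.iter i).rank
      deg := fun i => (S.iter i).deg
      d := fun i => (S.iter i).cover
      ε := ε
      d_homogeneous := fun i k l => (S.iter i).cover_homogeneous k l
      ε_homogeneous := fun k => ?_
      ε_surjective := fun y => ?_
      exact_zero := fun y => (SetLike.ext_iff.1 S.range_cover y).symm
      exact_succ := fun i y => (S.iter i).cover_eq_zero_iff y
      minimal := fun i k l => mem_span_range_X.2 ((S.iter i).coeff_zero _ ?_ l) }⟩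
  · refine ⟨1, C_1 (R := K) (σ := σ) ▸ C_mem_gradedPart (1 : K), ?_⟩
    have hk : k = (0 : Fin 1) := Subsingleton.elim (α := Fin 1) _ _
    subst hk
    change _ = Submodule.Quotient.mk ((Pi.single (0 : Fin 1) (1 : MvPolynomial σ K) : Fin 1 → _) 0)
    rw [Pi.single_eq_same]
    rfl
  · obtain ⟨p, rfl⟩ := Submodule.mkQ_surjective I y
    exact ⟨fun _ => p, rfl⟩
  · rw [← (S.iter i).range_cover]
    exact ⟨_, rfl⟩

end MvPolynomial

/-! ### Koszul cycles of squarefree monomial ideals with leaves -/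

namespace MvPolynomial

variable {V : Type*} [DecidableEq V]

/-- The exponent vector of the squarefree monomial `∏ v ∈ F, X v`. -/
noncomputable def faceExp (F : Finset V) : V →₀ ℕ := ∑ v ∈ F, Finsupp.single v 1

lemma faceExp_apply (F : Finset V) (v : V) : faceExp F v = if v ∈ F then 1 else 0 := by
  simp [faceExp, Finsupp.finsetSum_apply, Finsupp.single_apply]

lemma faceExp_injective : Function.Injective (faceExp (V := V)) := by
  intro F G h
  ext v
  have := DFunLike.congr_fun h v
  rw [faceExp_apply, faceExp_apply] at this
  by_cases h1 : v ∈ F <;> by_cases h2 : v ∈ G <;> simp_all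

lemma faceExp_insert {v : V} {B : Finset V} (h : v ∉ B) :
    faceExp (insert v B) = Finsupp.single v 1 + faceExp B := by
  rw [faceExp, Finset.sum_insert h, faceExp]

omit [DecidableEq V] in
lemma degree_faceExp (F : Finset V) : (faceExp F).degree = F.card := by
  simp [faceExp, map_sum]

omit [DecidableEq V] in
lemma prod_X_eq_monomial_faceExp (K : Type*) [Field K] (F : Finset V) :
    ∏ v ∈ F, (X v : MvPolynomial V K) = monomial (faceExp F) 1 := by
  rw [faceExp, monomial_sum_one]
  rfl

variable (K : Type*) [Field K]

/-- The span of the squarefree monomials `∏ v ∈ F, X v`, `F ∈ 𝓕`. -/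
noncomputable def faceSpan (𝓕 : Finset (Finset V)) : Submodule K (MvPolynomial V K) :=
  restrictSupport K (faceExp '' (𝓕 : Set (Finset V)))

variable {K}

omit [DecidableEq V] in
lemma mem_faceSpan {𝓕 : Finset (Finset V)} {p : MvPolynomial V K} :
    p ∈ faceSpan K 𝓕 ↔ ∀ m, coeff m p ≠ 0 → ∃ F ∈ 𝓕, faceExp F = m := by
  rw [faceSpan, mem_restrictSupport_iff]
  simp only [Set.subset_def, Finset.mem_coe, mem_support_iff, Set.mem_image]

omit [DecidableEq V] in
lemma monomial_mem_faceSpan {𝓕 : Finset (Finset V)} {F : Finset V} (hF : F ∈ 𝓕) (c : K) :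
    monomial (faceExp F) c ∈ faceSpan K 𝓕 := by
  rw [faceSpan, monomial_mem_restrictSupport]
  exact Or.inl ⟨F, hF, rfl⟩

instance (𝓕 : Finset (Finset V)) : Module.Finite K (faceSpan K 𝓕) := by
  have : Finite ↥(faceExp '' (𝓕 : Set (Finset V))) := (𝓕.finite_toSet.image _).to_subtype
  exact Module.Finite.of_basis (basisRestrictSupport K (faceExp '' (𝓕 : Set (Finset V))))

lemma finrank_faceSpan (𝓕 : Finset (Finset V)) : Module.finrank K (faceSpan K 𝓕) = 𝓕.card := by
  rw [faceSpan, Module.finrank_eq_nat_card_basis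
    (basisRestrictSupport K (faceExp '' (𝓕 : Set (Finset V)))), Nat.card_coe_set_eq,
    Set.ncard_image_of_injective _ faceExp_injective, Set.ncard_coe_finset]

variable [Fintype V]

instance {M : Type*} [AddCommGroup M] [Module (MvPolynomial V K) M] [Module K M]
    [IsScalarTower K (MvPolynomial V K) M] (A : Submodule K M) [Module.Finite K A] (p : ℕ) :
    Module.Finite K (koszulCycles A p : Submodule K (Finset V → M)) := by
  let f : (koszulCycles A p : Submodule K (Finset V → M)) →ₗ[K] (Finset V → A) :=
    LinearMap.pi fun S => ((LinearMap.proj S).comp (koszulCycles A p).subtype).codRestrict A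
      fun c => c.2.1 S
  refine Module.Finite.of_injective f fun c c' h => ?_
  ext1
  ext1 S
  exact congrArg Subtype.val (congrFun h S)

lemma koszulCycles_mono {𝓕 𝓖 : Finset (Finset V)} (h : 𝓕 ⊆ 𝓖) (p : ℕ) :
    (koszulCycles (faceSpan K 𝓕) p : Submodule K (Finset V → MvPolynomial V K)) ≤
      koszulCycles (faceSpan K 𝓖) p :=
  fun _ hc => ⟨fun S => restrictSupport_mono K (Set.image_mono (Finset.coe_subset.2 h)) (hc.1 S),
    hc.2⟩

section Leaf

variable {𝓕 : Finset (Finset V)} {F B : Finset V} {d n : ℕ}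

/-- In the boundary at `S.erase v`, the nonzero term on `x_v` times the monomial of `F` must be
cancelled by one coming from some `w ≠ v`, on the monomial of a set `H`. Then `H` arises from `F` by
exchanging `w` for `v`, so `F ∩ H = F.erase w ⊆ B` forces `B = F.erase w` and `H = insert v B`. -/
lemma insert_mem_of_coeff_ne_zero (hB : B ⊂ F) (hFB : ∀ H ∈ 𝓕, F ∩ H ⊆ B)
    {c : Finset V → MvPolynomial V K} (hc : c ∈ koszulCycles (faceSpan K (insert F 𝓕)) n)
    {S : Finset V} (hS : coeff (faceExp F) (c S) ≠ 0) {v : V} (hv : v ∈ S) :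
    insert v B ∈ 𝓕 := by
  have h0 : coeff (Finsupp.single v 1 + faceExp F) (koszulBoundary (K := K) c (S.erase v)) = 0 := by
    rw [hc.2.2]
    simp
  rw [coeff_koszulBoundary] at h0
  obtain ⟨w, hwv, hwm, hw⟩ : ∃ w, w ≠ v ∧ w ∈ (Finsupp.single v 1 + faceExp F).support ∧
      coeff (Finsupp.single v 1 + faceExp F - Finsupp.single w 1)
        (c (insert w (S.erase v))) ≠ 0 := by
    by_contra! hcon
    rw [Finset.sum_eq_single v (fun w _ hw => by
        split_ifs with hwm
        · rw [hcon w hw hwm, smul_zero]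
        · exact smul_zero _)
      (fun hn => absurd (by simp) hn), if_pos (by simp), add_tsub_cancel_left,
      Finset.insert_erase hv, zsmul_eq_mul] at h0
    have h2 := congrArg (fun t => (koszulSign v (S.erase v) : K) * t) h0
    simp only [← mul_assoc, ← Int.cast_mul, koszulSign_mul_self] at h2
    exact hS (by simpa using h2)
  obtain ⟨H, hH, hHm⟩ := mem_faceSpan.1 (hc.1 _) _ hw
  have hHu : ∀ u, (if u ∈ H then 1 else 0) =
      ((if v = u then 1 else 0) + if u ∈ F then 1 else 0) - if w = u then 1 else 0 := fun u => by
    have := DFunLike.congr_fun hHm u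
    simpa [faceExp_apply, Finsupp.single_apply] using this
  have hwF : w ∈ F := by
    by_contra hwF
    rw [Finsupp.mem_support_iff] at hwm
    simp [faceExp_apply, hwF, Ne.symm hwv] at hwm
  have hvH : v ∈ H ∧ v ∉ F := by
    have := hHu v
    rw [if_pos rfl, if_neg hwv] at this
    split_ifs at this <;> first | exact ⟨‹_›, ‹_›⟩ | lia
  have hHF : H ∈ 𝓕 := by
    rcases Finset.mem_insert.1 hH with rfl | h
    · exact absurd hvH.1 hvH.2
    · exact h
  have hmem : ∀ u, u ∈ H ↔ u = v ∨ (u ∈ F ∧ u ≠ w) := by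
    intro u
    have := hHu u
    by_cases h1 : v = u
    · subst h1
      simp [hvH.1]
    · by_cases h2 : w = u
      · subst h2
        have hwH : w ∉ H := fun h => by simp [h, hwF, Ne.symm hwv] at this
        simp [hwH, hwv]
      · rw [if_neg h1, if_neg h2] at this
        have hiff : u ∈ H ↔ u ∈ F := by
          split_ifs at this <;> tauto
        simp [hiff, Ne.symm h1, Ne.symm h2]
  have hBe : B = F.erase w := by
    symm
    have hsub : F.erase w ⊆ B := fun u hu => by
      obtain ⟨hu1, hu2⟩ := Finset.mem_erase.1 hu
      exact hFB H hHF (Finset.mem_inter.2 ⟨hu2, (hmem u).2 (Or.inr ⟨hu2, hu1⟩)⟩)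
    refine Finset.eq_of_subset_of_card_le hsub ?_
    have := Finset.card_lt_card hB
    rw [Finset.card_erase_of_mem hwF]
    lia
  have : insert v B = H := by
    ext u
    rw [hmem, hBe, Finset.mem_insert, Finset.mem_erase, and_comm (a := u ≠ w)]
  rwa [this]

/-- The cycle is, up to sign, the boundary of the monomial of `B` placed at `insert w S`. Its
entries are monomials of sets `insert v B` with `v ∈ insert w S`, and the monomial of `insert w B`
occurs only at `S`. -/
lemma exists_koszulCycle {w : V} (hw : w ∉ B) (hF : insert w B ∉ 𝓕) {S : Finset V}
    (hSn : S.card = n) (hSB : ∀ v ∈ S, v ∉ B) (hS : ∀ v ∈ S, insert v B ∈ 𝓕) :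
    ∃ c ∈ (koszulCycles (faceSpan K (insert (insert w B) 𝓕)) n :
        Submodule K (Finset V → MvPolynomial V K)),
      ∀ T : Finset V, (∀ v ∈ T, insert v B ∈ 𝓕) →
        coeff (faceExp (insert w B)) (c T) = if T = S then 1 else 0 := by
  have hwS : w ∉ S := fun h => hF (hS w h)
  let y : Finset V → MvPolynomial V K := Pi.single (insert w S) (monomial (faceExp B) 1)
  have hy : ∀ (T : Finset V) (v : V),
      koszulSign v T • (X v : MvPolynomial V K) • y (insert v T) =
        if insert v T = insert w S then
          koszulSign v T • monomial (Finsupp.single v 1 + faceExp B) (1 : K) else 0 := by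
    intro T v
    simp only [y, Pi.single_apply]
    split_ifs
    · rw [smul_eq_mul, X, monomial_mul, one_mul]
    · simp
  have hc : koszulBoundary (K := K) y ∈ (koszulCycles (faceSpan K (insert (insert w B) 𝓕)) n :
        Submodule K (Finset V → MvPolynomial V K)) := by
    refine ⟨fun T => ?_, ?_, koszulBoundary_koszulBoundary y⟩
    · rw [koszulBoundary_apply]
      refine Submodule.sum_mem _ fun v _ => ?_
      rw [hy]
      split_ifs with h
      · refine zsmul_mem ?_ _
        have hv : v ∈ insert w S := h ▸ Finset.mem_insert_self v T
        have hvB : v ∉ B ∧ insert v B ∈ insert (insert w B) 𝓕 := by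
          rcases Finset.mem_insert.1 hv with rfl | hv
          · exact ⟨hw, Finset.mem_insert_self _ _⟩
          · exact ⟨hSB v hv, Finset.mem_insert_of_mem (hS v hv)⟩
        rw [← faceExp_insert hvB.1]
        exact monomial_mem_faceSpan hvB.2 _
      · exact Submodule.zero_mem _
    · refine koszulBoundary_eq_zero_of_card fun T hT => ?_
      refine Pi.single_eq_of_ne ?_ _
      rintro rfl
      exact hT (by rw [Finset.card_insert_of_notMem hwS, hSn])
  refine ⟨koszulSign w S • koszulBoundary (K := K) y, zsmul_mem hc _, fun T hT => ?_⟩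
  have hwT : w ∉ T := fun h => hF (hT w h)
  rw [Pi.smul_apply, koszulBoundary_apply, Finset.sum_eq_single w]
  · rw [hy]
    by_cases hTS : T = S
    · subst hTS
      rw [if_pos rfl, if_pos rfl, smul_smul, koszulSign_mul_self, one_smul, ← faceExp_insert hw,
        coeff_monomial, if_pos rfl]
    · rw [if_neg hTS, if_neg, smul_zero, coeff_zero]
      intro h
      apply hTS
      rw [← Finset.erase_insert hwT, h, Finset.erase_insert hwS]
  · intro v hv hvw
    rw [hy, if_neg]
    intro h
    have : w ∈ insert v T := h ▸ Finset.mem_insert_self w S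
    rcases Finset.mem_insert.1 this with h | h
    · exact hvw h.symm
    · exact hwT h
  · intro h
    exact absurd (by simpa using hwT) h

/-- Rank-nullity for the map `ρ` that reads the coefficient of the monomial of `F` at the
`n`-subsets of `W`. The cycles of `exists_koszulCycle` hit the standard basis; by
`insert_mem_of_coeff_ne_zero` that coefficient vanishes at all other sets, so the kernel is the
cycle space of `𝓕`. -/
lemma finrank_koszulCycles_insert (hcard : ∀ H ∈ insert F 𝓕, H.card = d + 1) (hF : F ∉ 𝓕)
    (hB : B ⊂ F) (hFB : ∀ H ∈ 𝓕, F ∩ H ⊆ B) (hn : 0 < n) :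
    Module.finrank K (koszulCycles (faceSpan K (insert F 𝓕)) n :
        Submodule K (Finset V → MvPolynomial V K)) =
      Module.finrank K (koszulCycles (faceSpan K 𝓕) n :
        Submodule K (Finset V → MvPolynomial V K)) +
        (Finset.univ.filter fun w => insert w B ∈ 𝓕).card.choose n := by
  set W := Finset.univ.filter fun w => insert w B ∈ 𝓕 with hW
  let ρ : (koszulCycles (faceSpan K (insert F 𝓕)) n :
      Submodule K (Finset V → MvPolynomial V K)) →ₗ[K] (↥(Finset.powersetCard n W) → K) :=
    LinearMap.pi fun S => (lcoeff K (faceExp F)).comp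
      ((LinearMap.proj S.1).comp (koszulCycles (faceSpan K (insert F 𝓕)) n).subtype)
  have hρ : ∀ c S, ρ c S = coeff (faceExp F) (c.1 S.1) := fun _ _ => rfl
  have hWmem : ∀ S : ↥(Finset.powersetCard n W), ∀ v ∈ S.1, insert v B ∈ 𝓕 := fun S v hv =>
    (Finset.mem_filter.1 ((Finset.mem_powersetCard.1 S.2).1 hv)).2
  have hsurj : LinearMap.range ρ = ⊤ := by
    have hex : ∀ S : ↥(Finset.powersetCard n W), ∃ c, ρ c = Pi.single S 1 := by
      intro S
      have hSn := (Finset.mem_powersetCard.1 S.2).2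
      have hBlt := Finset.card_lt_card hB
      have hFc := hcard F (Finset.mem_insert_self _ _)
      have hnotB : ∀ v ∈ S.1, v ∉ B := fun v hv hvB => by
        have := hcard _ (Finset.mem_insert_of_mem (hWmem S v hv))
        rw [Finset.insert_eq_of_mem hvB] at this
        lia
      obtain ⟨v, hv⟩ := Finset.card_pos.1 (hSn ▸ hn)
      -- As `n > 0`, the set `S` supplies some `insert v B` in the family, which fixes the size of
      -- `B`.
      have hBc : B.card = d := by
        have := hcard _ (Finset.mem_insert_of_mem (hWmem S v hv))
        rw [Finset.card_insert_of_notMem (hnotB v hv)] at this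
        lia
      obtain ⟨w, hw, rfl⟩ : ∃ w ∉ B, insert w B = F := by
        obtain ⟨w, hwF, hwB⟩ := Finset.exists_of_ssubset hB
        refine ⟨w, hwB, Finset.eq_of_subset_of_card_le ?_ ?_⟩
        · exact Finset.insert_subset hwF hB.subset
        · rw [Finset.card_insert_of_notMem hwB, hBc, hFc]
      obtain ⟨c, hc, hcT⟩ := exists_koszulCycle (K := K) hw hF hSn hnotB (hWmem S)
      refine ⟨⟨c, hc⟩, ?_⟩
      ext1 T
      rw [hρ, hcT T.1 (hWmem T), Pi.single_apply]
      simp only [Subtype.ext_iff]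
    rw [LinearMap.range_eq_top]
    intro y
    choose c hc using hex
    refine ⟨∑ S, y S • c S, ?_⟩
    ext1 T
    simp [map_sum, hc, Pi.single_apply]
  have hker : (LinearMap.ker ρ).map (koszulCycles (faceSpan K (insert F 𝓕)) n).subtype =
      (koszulCycles (faceSpan K 𝓕) n : Submodule K (Finset V → MvPolynomial V K)) := by
    apply le_antisymm
    · rintro _ ⟨⟨c, hc⟩, hcρ, rfl⟩
      refine ⟨fun S => mem_faceSpan.2 fun m hm => ?_, hc.2⟩
      obtain ⟨H, hH, rfl⟩ := mem_faceSpan.1 (hc.1 S) m hm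
      rcases Finset.mem_insert.1 hH with rfl | hH
      · have hSW : S ∈ Finset.powersetCard n W := by
          rw [Finset.mem_powersetCard]
          constructor
          · intro v hv
            exact Finset.mem_filter.2
              ⟨Finset.mem_univ v, insert_mem_of_coeff_ne_zero hB hFB hc hm hv⟩
          · by_contra hne
            exact hm (by
              change coeff _ (c S) = 0
              rw [hc.2.1 S hne, coeff_zero])
        exact absurd (congrFun hcρ ⟨S, hSW⟩) hm
      · exact ⟨H, hH, rfl⟩
    · intro c hc
      refine ⟨⟨c, koszulCycles_mono (Finset.subset_insert F 𝓕) n hc⟩, ?_, rfl⟩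
      refine _root_.funext fun S => ?_
      by_contra hne
      obtain ⟨H, hH, hHF⟩ := mem_faceSpan.1 (hc.1 S.1) _ hne
      exact hF (faceExp_injective hHF ▸ hH)
  rw [← LinearMap.finrank_range_add_finrank_ker ρ, hsurj, finrank_top, Module.finrank_pi,
    Fintype.card_coe, Finset.card_powersetCard, add_comm, ← hker, Submodule.finrank_map_subtype_eq]

/-- Pascal's rule gives each `G ⊆ F` the increment `m(G).choose (n + 1)`, with `m(G)` counted in
`𝓕`. It vanishes unless `G` lies in some `H ∈ 𝓕`, and then `G ⊆ F ∩ H ⊆ B` with `B.card ≤ d` forces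
`G = B`. If `B.card < d`, both the increment and the last term are zero. -/
lemma sum_choose_insert (hcard : ∀ H ∈ insert F 𝓕, H.card = d + 1) (hF : F ∉ 𝓕)
    (hB : B ⊂ F) (hFB : ∀ H ∈ 𝓕, F ∩ H ⊆ B) (n : ℕ) :
    ∑ G ∈ Finset.powersetCard d Finset.univ, ((insert F 𝓕).filter (G ⊆ ·)).card.choose (n + 2) =
      ∑ G ∈ Finset.powersetCard d Finset.univ, (𝓕.filter (G ⊆ ·)).card.choose (n + 2) +
        (Finset.univ.filter fun w => insert w B ∈ 𝓕).card.choose (n + 1) := by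
  have hstep : ∀ G : Finset V, ((insert F 𝓕).filter (G ⊆ ·)).card.choose (n + 2) =
      (𝓕.filter (G ⊆ ·)).card.choose (n + 2) +
        if G ⊆ F then (𝓕.filter (G ⊆ ·)).card.choose (n + 1) else 0 := by
    intro G
    rw [Finset.filter_insert]
    split_ifs
    · rw [Finset.card_insert_of_notMem fun h => hF (Finset.mem_filter.1 h).1, Nat.choose_succ_succ,
        add_comm]
    · rfl
  rw [Finset.sum_congr rfl fun G _ => hstep G, Finset.sum_add_distrib, Nat.add_left_cancel_iff]
  have hBlt := Finset.card_lt_card hB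
  have hFc := hcard F (Finset.mem_insert_self _ _)
  have hnotB : ∀ w, insert w B ∈ 𝓕 → w ∉ B := fun w hw hwB => by
    have := hcard _ (Finset.mem_insert_of_mem hw)
    rw [Finset.insert_eq_of_mem hwB] at this
    lia
  have hGB : ∀ G : Finset V, G.card = d → G ⊆ F → (𝓕.filter (G ⊆ ·)).Nonempty → G = B := by
    rintro G hG hGF ⟨H, hH⟩
    obtain ⟨hH, hGH⟩ := Finset.mem_filter.1 hH
    refine Finset.eq_of_subset_of_card_le ((Finset.subset_inter hGF hGH).trans (hFB H hH)) ?_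
    lia
  have hzero : ∀ G ∈ Finset.powersetCard d Finset.univ, G ≠ B →
      (if G ⊆ F then (𝓕.filter (G ⊆ ·)).card.choose (n + 1) else 0) = 0 := by
    intro G hG hne
    split_ifs with hGF
    · rcases Finset.eq_empty_or_nonempty (𝓕.filter (G ⊆ ·)) with h | h
      · rw [h, Finset.card_empty, Nat.choose_zero_succ]
      · exact absurd (hGB G (Finset.mem_powersetCard.1 hG).2 hGF h) hne
    · rfl
  by_cases hBd : B.card = d
  · rw [Finset.sum_eq_single B hzero
      (fun h => absurd (Finset.mem_powersetCard.2 ⟨Finset.subset_univ B, hBd⟩) h),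
      if_pos hB.subset]
    congr 1
    symm
    refine Finset.card_bij (fun w _ => insert w B) ?_ ?_ ?_
    · intro w hw
      exact Finset.mem_filter.2 ⟨(Finset.mem_filter.1 hw).2, Finset.subset_insert w B⟩
    · intro w hw w' hw' h
      have : w ∈ insert w' B := h ▸ Finset.mem_insert_self w B
      rcases Finset.mem_insert.1 this with h | h
      · exact h
      · exact absurd h (hnotB w (Finset.mem_filter.1 hw).2)
    · intro H hH
      obtain ⟨hH, hBH⟩ := Finset.mem_filter.1 hH
      have hHc := hcard H (Finset.mem_insert_of_mem hH)
      obtain ⟨w, hw, hwB⟩ := Finset.exists_mem_notMem_of_card_lt_card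
        (show B.card < H.card by lia)
      have : insert w B = H := Finset.eq_of_subset_of_card_le (Finset.insert_subset hw hBH) (by
        rw [Finset.card_insert_of_notMem hwB, hHc, hBd])
      exact ⟨w, Finset.mem_filter.2 ⟨Finset.mem_univ w, this ▸ hH⟩, this⟩
  · have hW : (Finset.univ.filter fun w => insert w B ∈ 𝓕) = ∅ := by
      refine Finset.filter_eq_empty_iff.2 fun w _ hw => hBd ?_
      have := hcard _ (Finset.mem_insert_of_mem hw)
      rw [Finset.card_insert_of_notMem (hnotB w hw)] at this
      lia
    rw [hW, Finset.card_empty, Nat.choose_zero_succ]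
    refine Finset.sum_eq_zero fun G hG => hzero G hG ?_
    rintro rfl
    exact hBd (Finset.mem_powersetCard.1 hG).2

theorem finrank_koszulCycles_faceSpan (n : ℕ) (𝓕 : Finset (Finset V))
    (hcard : ∀ H ∈ 𝓕, H.card = d + 1)
    (hleaf : ∀ 𝓖 ⊆ 𝓕, 𝓖.Nonempty → ∃ F ∈ 𝓖, ∃ B ⊂ F, ∀ H ∈ 𝓖, H ≠ F → F ∩ H ⊆ B) :
    Module.finrank K (koszulCycles (faceSpan K 𝓕) (n + 1) :
        Submodule K (Finset V → MvPolynomial V K)) =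
      ∑ G ∈ Finset.powersetCard d Finset.univ, (𝓕.filter (G ⊆ ·)).card.choose (n + 2) := by
  induction 𝓕 using Finset.strongInduction with
  | H 𝓕 ih =>
    rcases 𝓕.eq_empty_or_nonempty with rfl | hne
    · have : (koszulCycles (faceSpan K ∅) (n + 1) :
          Submodule K (Finset V → MvPolynomial V K)) = ⊥ := by
        rw [eq_bot_iff]
        intro c hc
        rw [Submodule.mem_bot]
        ext1 S
        ext1 m
        by_contra h
        obtain ⟨F, hF, _⟩ := mem_faceSpan.1 (hc.1 S) m h
        exact absurd hF (Finset.notMem_empty F)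
      rw [this, finrank_bot]
      simp
    · obtain ⟨F, hF, B, hB, hFB⟩ := hleaf 𝓕 subset_rfl hne
      have hins : insert F (𝓕.erase F) = 𝓕 := Finset.insert_erase hF
      have hFB' : ∀ H ∈ 𝓕.erase F, F ∩ H ⊆ B := fun H hH =>
        hFB H (Finset.mem_of_mem_erase hH) (Finset.ne_of_mem_erase hH)
      have hcard' : ∀ H ∈ insert F (𝓕.erase F), H.card = d + 1 := hins.symm ▸ hcard
      have h1 := ih (𝓕.erase F) (Finset.erase_ssubset hF)
        (fun H hH => hcard H (Finset.mem_of_mem_erase hH))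
        (fun 𝓖 h𝓖 => hleaf 𝓖 (h𝓖.trans (Finset.erase_subset _ _)))
      have h2 := finrank_koszulCycles_insert (K := K) hcard' (Finset.notMem_erase F 𝓕) hB hFB'
        n.succ_pos
      have h3 := sum_choose_insert hcard' (Finset.notMem_erase F 𝓕) hB hFB' n
      rw [hins] at h2 h3
      rw [h2, h3, h1]

end Leaf

end MvPolynomial

/-! ### The resolution of a cyclic module -/

namespace MvPolynomial

section Congr

variable {K V : Type*} [Field K] [Fintype V] [DecidableEq V]
  {M N : Type*} [AddCommGroup M] [Module (MvPolynomial V K) M] [AddCommGroup N]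
  [Module (MvPolynomial V K) N] [Module K M] [IsScalarTower K (MvPolynomial V K) M]
  [Module K N] [IsScalarTower K (MvPolynomial V K) N]

lemma comp_mem_koszulCycles {A : Submodule K M} {B : Submodule K N}
    (φ : M →ₗ[MvPolynomial V K] N) (h : ∀ x ∈ A, φ x ∈ B) {p : ℕ} {c : Finset V → M}
    (hc : c ∈ koszulCycles A p) : (fun S => φ (c S)) ∈ koszulCycles B p :=
  ⟨fun S => h _ (hc.1 S), fun S hS => (congrArg φ (hc.2.1 S hS)).trans (map_zero φ), by
    rw [koszulBoundary_comp, hc.2.2]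
    ext1 S
    exact map_zero φ⟩

lemma finrank_koszulCycles_congr {A : Submodule K M} {B : Submodule K N}
    (φ : M ≃ₗ[MvPolynomial V K] N) (h : ∀ x, x ∈ A ↔ φ x ∈ B) (p : ℕ) :
    Module.finrank K (koszulCycles A p : Submodule K (Finset V → M)) =
      Module.finrank K (koszulCycles B p : Submodule K (Finset V → N)) := by
  let f : (koszulCycles A p : Submodule K (Finset V → M)) →ₗ[K]
      (koszulCycles B p : Submodule K (Finset V → N)) :=
    (((φ.toLinearMap.restrictScalars K).compLeft (Finset V)).comp
      (koszulCycles A p).subtype).codRestrict _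
      fun c => comp_mem_koszulCycles φ.toLinearMap (fun x => (h x).1) c.2
  refine (LinearEquiv.ofBijective f ⟨?_, ?_⟩).finrank_eq
  · intro c c' hcc
    ext1
    ext1 S
    exact φ.injective (congrFun (congrArg Subtype.val hcc) S)
  · rintro ⟨c, hc⟩
    refine ⟨⟨_, comp_mem_koszulCycles (A := B) (B := A) φ.symm.toLinearMap
      (fun x hx => (h _).2 (by simpa using hx)) hc⟩, ?_⟩
    ext1
    ext1 S
    exact φ.apply_symm_apply (c S)

end Congr

end MvPolynomial

namespace MinimalGradedFreeResolution

open MvPolynomial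

variable {K V : Type*} [Field K] {I : Ideal (MvPolynomial V K)}
  (F : MinimalGradedFreeResolution (σ := V) (quotientGradedPart I))

/-- An arbitrary minimal resolution of `R/I` begins with a copy of `R` in degree `0`, up to a unit,
so its first syzygies can be identified with `I`. -/
lemma exists_generator (hI : ∀ f ∈ I, coeff 0 f = 0) :
    ∃ k₀ : Fin (F.rank 0), (∀ k, k = k₀) ∧ F.deg 0 k₀ = 0 ∧
      ∀ f, f ∈ LinearMap.range (F.d 0) ↔ f k₀ ∈ I := by
  have hp : ∀ k, ∃ p ∈ gradedPart K V (F.deg 0 k), Ideal.Quotient.mk I p = F.ε (Pi.single k 1) :=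
    fun k => F.ε_homogeneous k
  choose p hp hpε using hp
  have hsmul : ∀ (q r : MvPolynomial V K),
      q • (Ideal.Quotient.mk I r : MvPolynomial V K ⧸ I) = Ideal.Quotient.mk I (q * r) :=
    fun _ _ => rfl
  obtain ⟨u, hu⟩ := F.ε_surjective (Ideal.Quotient.mk I 1)
  -- With `p k` representing `ε e_k` and `u` lifting `1`, the vector `e_k - p k • u` is a syzygy and
  -- has no constant terms. Hence the identity matrix is a column times a row, which leaves room for
  -- at most one generator.
  have hmul : ∀ k l, coeff 0 (Pi.single (M := fun _ => MvPolynomial V K) k 1 l) =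
      coeff 0 (p k) * coeff 0 (u l) := by
    intro k l
    have h1 : Pi.single k 1 - p k • u ∈ LinearMap.range (F.d 0) := by
      rw [← F.ker_ε, LinearMap.mem_ker, map_sub, map_smul, hu, ← hpε, hsmul, mul_one, sub_self]
    have h2 := F.coeff_zero_of_mem_range 0 h1 l
    rw [Pi.sub_apply, coeff_sub, sub_eq_zero] at h2
    rw [h2, Pi.smul_apply, smul_eq_mul]
    exact map_mul constantCoeff (p k) (u l)
  have hne : ∀ k, coeff 0 (p k) ≠ 0 ∧ coeff 0 (u k) ≠ 0 := by
    intro k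
    have := hmul k k
    rw [Pi.single_eq_same, coeff_zero_one] at this
    exact ⟨left_ne_zero_of_mul (this ▸ one_ne_zero), right_ne_zero_of_mul (this ▸ one_ne_zero)⟩
  have huniq : ∀ k l : Fin (F.rank 0), l = k := by
    intro k l
    by_contra hkl
    have := hmul k l
    rw [Pi.single_eq_of_ne hkl, coeff_zero] at this
    exact mul_ne_zero (hne k).1 (hne l).2 this.symm
  have hrank : Nonempty (Fin (F.rank 0)) := by
    by_contra hcon
    rw [not_nonempty_iff] at hcon
    have h0 : u = 0 := Subsingleton.elim _ _
    rw [h0, map_zero] at hu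
    have h1 := hI 1 (Ideal.Quotient.eq_zero_iff_mem.1 hu.symm)
    rw [coeff_zero_one] at h1
    exact one_ne_zero h1
  obtain ⟨k₀⟩ := hrank
  have hdeg : F.deg 0 k₀ = 0 := by
    by_contra h
    exact (hne k₀).1 (coeff_zero_of_mem_gradedPart h (hp k₀))
  refine ⟨k₀, huniq k₀, hdeg, fun f => ?_⟩
  have hf : f = f k₀ • Pi.single k₀ 1 := by
    ext1 k
    rw [huniq k₀ k]
    simp
  have hpC := eq_C_of_mem_gradedPart hdeg.le (hp k₀)
  have hunit : IsUnit (p k₀) := by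
    rw [hpC]
    exact (isUnit_iff_ne_zero.2 (hne k₀).1).map C
  rw [← F.ker_ε, LinearMap.mem_ker, hf, map_smul, ← hpε, hsmul, Ideal.Quotient.eq_zero_iff_mem,
    Ideal.mul_unit_mem_iff_mem I hunit]
  simp

/-- The linear strand of the resolution of `R/I`, for an ideal `I` generated in degrees at
least `e > 0`. -/
theorem betti_quotient_eq_finrank_koszulCycles [Fintype V] [DecidableEq V] {e : ℕ} (he : 0 < e)
    (hI : ∀ f ∈ I, ∀ m, coeff m f ≠ 0 → e ≤ m.degree) (n : ℕ) :
    F.betti (n + 1) (e + n) = Module.finrank K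
      (koszulCycles (I.restrictScalars K ⊓ gradedPart K V e) n :
        Submodule K (Finset V → MvPolynomial V K)) := by
  obtain ⟨k₀, huniq, hdeg, hrange⟩ := F.exists_generator fun f hf => by
    by_contra hne
    have := hI f hf 0 hne
    rw [map_zero] at this
    lia
  let _ : Unique (Fin (F.rank 0)) := ⟨⟨k₀⟩, huniq⟩
  rw [F.betti_eq_finrank_koszulCycles]
  · refine finrank_koszulCycles_congr
      (LinearEquiv.funUnique (Fin (F.rank 0)) (MvPolynomial V K) (MvPolynomial V K))
      (fun f => and_congr (hrange f) ?_) n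
    constructor
    · intro hf
      have := hf k₀
      rwa [hdeg, sub_zero] at this
    · intro hf k
      rw [huniq k, hdeg, sub_zero]
      exact hf
  · intro j hj f hf hfj
    ext1 k
    ext m
    rw [huniq k]
    by_contra hne
    have h1 := hI _ ((hrange f).1 hf) m hne
    have h2 := hfj k₀ m hne
    rw [hdeg] at h2
    lia

end MinimalGradedFreeResolution

/-! ### Facet ideals -/

namespace PreAbstractSimplicialComplex

open MvPolynomial

variable {V : Type*} [Fintype V] (Δ : PreAbstractSimplicialComplex V)

variable {Δ} in
lemma mem_facets {F : Finset V} : F ∈ Δ.facets ↔ Maximal (fun s => s ∈ Δ) F := by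
  simp [facets]

section Ideal

variable {Δ} {K : Type*} [Field K]

lemma mem_facetIdeal [DecidableEq V] {f : MvPolynomial V K} :
    f ∈ Δ.facetIdeal K ↔ ∀ m, coeff m f ≠ 0 → ∃ F ∈ Δ.facets, faceExp F ≤ m := by
  have h : {f : MvPolynomial V K | ∃ F ∈ Δ.facets, f = ∏ v ∈ F, X v} =
      (fun m => monomial m (1 : K)) '' (faceExp '' (Δ.facets : Set (Finset V))) := by
    ext f
    simp [prod_X_eq_monomial_faceExp, eq_comm]
  rw [facetIdeal, h, mem_ideal_span_monomial_image]
  simp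

lemma gradedProj_mem_facetIdeal [DecidableEq V] {f : MvPolynomial V K} (hf : f ∈ Δ.facetIdeal K)
    (j : ℤ) : gradedProj j f ∈ Δ.facetIdeal K := by
  rw [mem_facetIdeal] at hf ⊢
  intro m hm
  rw [coeff_gradedProj] at hm
  exact hf m (ite_ne_right_iff.1 hm).2

omit [Fintype V] in
lemma degree_faceExp_le [DecidableEq V] {F : Finset V} {m : V →₀ ℕ} (h : faceExp F ≤ m) :
    F.card ≤ m.degree := by
  rw [← degree_faceExp, ← add_tsub_cancel_of_le h, map_add]
  exact Nat.le_add_right _ _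

/-- A monomial divisible by a facet monomial and of the same degree equals it. -/
lemma facetIdeal_inf_gradedPart [DecidableEq V] {e : ℕ} (hcard : ∀ F ∈ Δ.facets, F.card = e) :
    (Δ.facetIdeal K).restrictScalars K ⊓ gradedPart K V e = faceSpan K Δ.facets := by
  ext f
  rw [Submodule.mem_inf, Submodule.restrictScalars_mem, mem_facetIdeal, mem_faceSpan]
  constructor
  · rintro ⟨h1, h2⟩ m hm
    obtain ⟨F, hF, hle⟩ := h1 m hm
    refine ⟨F, hF, ?_⟩
    have hm' := h2 m hm
    have h3 : m.degree = (faceExp F).degree + (m - faceExp F).degree := by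
      rw [← map_add, add_tsub_cancel_of_le hle]
    rw [degree_faceExp, hcard F hF] at h3
    have h4 : m - faceExp F = 0 := (Finsupp.degree_eq_zero_iff _).1 (by lia)
    exact le_antisymm hle (tsub_eq_zero_iff_le.1 h4)
  · intro h
    constructor
    · intro m hm
      obtain ⟨F, hF, rfl⟩ := h m hm
      exact ⟨F, hF, le_rfl⟩
    · intro m hm
      obtain ⟨F, hF, rfl⟩ := h m hm
      rw [degree_faceExp, hcard F hF]

/-- The linear strand of the facet ideal of a pure complex. -/
theorem hasGradedBetti_facetIdeal [DecidableEq V] {d : ℕ}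
    (hcard : ∀ F ∈ Δ.facets, F.card = d + 1) (n : ℕ) :
    HasGradedBetti V (quotientGradedPart (Δ.facetIdeal K)) (n + 1) ((n + 1 : ℕ) + d : ℤ)
      (Module.finrank K (koszulCycles (faceSpan K Δ.facets) n :
        Submodule K (Finset V → MvPolynomial V K))) := by
  have hdeg : ∀ f ∈ Δ.facetIdeal K, ∀ m, coeff m f ≠ 0 → d + 1 ≤ m.degree := fun f hf m hm => by
    obtain ⟨F, hF, hle⟩ := mem_facetIdeal.1 hf m hm
    exact hcard F hF ▸ degree_faceExp_le hle
  refine ⟨nonempty_minimalGradedFreeResolution (fun f hf => gradedProj_mem_facetIdeal hf)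
    fun f hf => ?_, fun F => ?_⟩
  · by_contra hne
    have := hdeg f hf 0 hne
    rw [map_zero] at this
    lia
  · rw [← facetIdeal_inf_gradedPart hcard,
      ← F.betti_quotient_eq_finrank_koszulCycles d.succ_pos hdeg n]
    congr 1
    push_cast
    ring

end Ideal

variable {Δ}

lemma card_of_mem_facets {d : ℕ} (hdim : Δ.HasDim d) (hpure : Δ.IsPure) {F : Finset V}
    (hF : F ∈ Δ.facets) : F.card = d + 1 := by
  obtain ⟨F₀, hF₀, hd⟩ := hdim.1
  have hmax : F₀ ∈ Δ.facets := by
    refine mem_facets.2 ⟨hF₀, fun G hG hle => ?_⟩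
    have h1 : faceDim G ≤ d := hdim.2 ⟨G, hG, rfl⟩
    rw [← hd, faceDim, faceDim] at h1
    exact (Finset.eq_of_subset_of_card_le hle (by lia)).symm.le
  have h2 := hpure F hF F₀ hmax
  rw [hd, faceDim] at h2
  lia

/-- The leaf property is applied to the subcomplex generated by `𝓖`. Its facets are exactly the
members of `𝓖`, since distinct facets of `Δ` are incomparable. -/
lemma exists_leaf [DecidableEq V] {d : ℕ} (hcard : ∀ F ∈ Δ.facets, F.card = d + 1)
    (htree : Δ.IsTree) {𝓖 : Finset (Finset V)} (h𝓖 : 𝓖 ⊆ Δ.facets) (hne : 𝓖.Nonempty) :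
    ∃ F ∈ 𝓖, ∃ B ⊂ F, ∀ H ∈ 𝓖, H ≠ F → F ∩ H ⊆ B := by
  have hnonempty : ∀ F ∈ 𝓖, F.Nonempty := fun F hF =>
    Finset.card_pos.1 (by rw [hcard F (h𝓖 hF)]; exact d.succ_pos)
  let Γ : PreAbstractSimplicialComplex V :=
    { faces := {s | s.Nonempty ∧ ∃ F ∈ 𝓖, s ⊆ F}
      isRelLowerSet_faces := fun _ hs =>
        ⟨hs.1, fun _ hts ht => ⟨ht, hs.2.imp fun _ hF => ⟨hF.1, hts.trans hF.2⟩⟩⟩ }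
  have hmem : ∀ s, s ∈ Γ ↔ s.Nonempty ∧ ∃ F ∈ 𝓖, s ⊆ F := fun _ => Iff.rfl
  have hΓ : Γ.facets = 𝓖 := by
    ext F
    rw [mem_facets]
    constructor
    · rintro ⟨hF, hmax⟩
      obtain ⟨_, G, hG, hFG⟩ := (hmem F).1 hF
      have : G = F := le_antisymm (hmax ((hmem G).2 ⟨hnonempty G hG, G, hG, subset_rfl⟩) hFG) hFG
      exact this ▸ hG
    · intro hF
      refine ⟨(hmem F).2 ⟨hnonempty F hF, F, hF, subset_rfl⟩, fun s hs hle => ?_⟩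
      obtain ⟨_, G, hG, hsG⟩ := (hmem s).1 hs
      exact hsG.trans ((mem_facets.1 (h𝓖 hF)).2 (mem_facets.1 (h𝓖 hG)).1 (hle.trans hsG))
  obtain ⟨F, hF, hleaf⟩ := htree.2 Γ (hΓ ▸ h𝓖) (hΓ.symm ▸ hne)
  rw [hΓ] at hF hleaf
  refine ⟨F, hF, ?_⟩
  rcases hleaf with h | ⟨G, hG, hGF, h⟩
  · refine ⟨∅, Finset.empty_ssubset.2 (hnonempty F hF), fun H hH hHF => ?_⟩
    rw [h] at hH
    exact absurd (Finset.mem_singleton.1 hH) hHF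
  -- The intersection is proper because `F` and `G` are distinct sets of the same size.
  · refine ⟨F ∩ G, Finset.inter_subset_left.ssubset_of_ne fun heq => hGF ?_, h⟩
    refine (Finset.eq_of_subset_of_card_le (Finset.inter_eq_left.1 heq) ?_).symm
    rw [hcard F (h𝓖 hF), hcard G (h𝓖 hG)]

lemma mem_adjacentFaces [DecidableEq V] {d : ℕ} {G : Finset V} :
    G ∈ Δ.adjacentFaces d ↔ Δ.IsFace G ∧ faceDim G = (d : ℤ) - 1 ∧ 2 ≤ Δ.facetCount G := by
  simp only [adjacentFaces, Finset.mem_filter, Finset.mem_univ, true_and]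
  convert Iff.rfl

/-- The extra `d`-subsets contribute nothing: a set in at least `i ≥ 2` facets is an adjacent face,
and otherwise the binomial coefficient is zero. -/
lemma sum_adjacentFaces_choose [DecidableEq V] (d : ℕ) {i : ℕ} (hi : 2 ≤ i) :
    ∑ G ∈ Δ.adjacentFaces d, (Δ.facetCount G).choose i =
      ∑ G ∈ Finset.powersetCard d Finset.univ, (Δ.facets.filter (G ⊆ ·)).card.choose i := by
  refine Finset.sum_subset (fun G hG => ?_) fun G hG hn => ?_
  · have := (mem_adjacentFaces.1 hG).2.1
    rw [faceDim] at this
    exact Finset.mem_powersetCard.2 ⟨Finset.subset_univ G, by lia⟩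
  · refine Nat.choose_eq_zero_of_lt ?_
    by_contra! hlt
    refine hn (mem_adjacentFaces.2 ⟨?_, ?_, hi.trans hlt⟩)
    · rcases G.eq_empty_or_nonempty with h | h
      · exact Or.inl h
      · obtain ⟨F, hF⟩ := Finset.card_pos.1 ((show 0 < i by lia).trans_le hlt)
        obtain ⟨hF, hGF⟩ := Finset.mem_filter.1 hF
        exact Or.inr ((Δ.isRelLowerSet_faces (mem_facets.1 hF).1).2 hGF h)
    · rw [faceDim, (Finset.mem_powersetCard.1 hG).2]

end PreAbstractSimplicialComplex

theorem proposition3p3 {V : Type*} [Fintype V] [DecidableEq V] {K : Type*} [Field K]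
    (Δ : AbstractSimplicialComplex V) (d m : ℕ)
    (hdim : Δ.toPreAbstractSimplicialComplex.HasDim d)
    (hpure : Δ.toPreAbstractSimplicialComplex.IsPure)
    (htree : Δ.toPreAbstractSimplicialComplex.IsTree)
    (hconn : Δ.toPreAbstractSimplicialComplex.IsConnectedInCodimOne)
    (hm : Δ.toPreAbstractSimplicialComplex.facets.card = m) :
    HasGradedBetti V
        (MvPolynomial.quotientGradedPart (Δ.toPreAbstractSimplicialComplex.facetIdeal K))
        1 (1 + d) m ∧
      ∀ i : ℕ, 2 ≤ i →
        HasGradedBetti V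
          (MvPolynomial.quotientGradedPart (Δ.toPreAbstractSimplicialComplex.facetIdeal K))
          i (i + d)
          (∑ G ∈ Δ.toPreAbstractSimplicialComplex.adjacentFaces d,
            (Δ.toPreAbstractSimplicialComplex.facetCount G).choose i) := by
  have hcard := fun F => PreAbstractSimplicialComplex.card_of_mem_facets hdim hpure (F := F)
  constructor
  · have h := PreAbstractSimplicialComplex.hasGradedBetti_facetIdeal (K := K) hcard 0
    rw [MvPolynomial.finrank_koszulCycles_zero, MvPolynomial.finrank_faceSpan, hm] at h
    exact_mod_cast h
  · intro i hi
    obtain ⟨n, rfl⟩ := Nat.exists_eq_add_of_le' hi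
    rw [PreAbstractSimplicialComplex.sum_adjacentFaces_choose d hi,
      ← MvPolynomial.finrank_koszulCycles_faceSpan (K := K) n _ hcard
        fun 𝓖 => PreAbstractSimplicialComplex.exists_leaf hcard htree]
    exact PreAbstractSimplicialComplex.hasGradedBetti_facetIdeal hcard (n + 1)
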